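/- Let $K\ge 1$ and $N_0\ge 1$ be integers. For integers $N_1,\dots,N_K$ with $N_k\ge N_0$ for all $k$ (in any order), let $\mathbf Q_1,\dots,\mathbf Q_K$ be independent random matrices, $\mathbf Q_k$ of size $N_k\times N_{k-1}$ with i.i.d. circularly symmetric complex Gaussian entries of mean zero and unit variance (density $e^{-|z|^2}/\pi$). Let $\mathbf H=\mathbf Q_K\mathbf Q_{K-1}\cdots\mathbf Q_1$ be the Rayleigh product channel with setting $(N_0,N_1,\dots,N_K)$, and for $q>0$ let $$\tilde R(N_0,\dots,N_K;q)=\mathbb E\big[\ln\det(\mathbf I+q\,\mathbf H^\dagger\mathbf H)\big]$$ be its ergodic capacity (nats per channel use). Call $q\prod_{k=1}^K N_k$ the signal-to-noise ratio (SNR) of the setting; it is the mean of each diagonal entry of $q\mathbf H^\dagger\mathbf H$. Let $\psi=\Gamma'/\Gamma$ be the digamma function, so that $\psi(n)=-\gamma+\sum_{r=1}^{n-1}\frac1r$ for integers $n\ge1$. Then the following hold. 1. The random variable $\ln\det(\mathbf I+q\mathbf H^\dagger\mathbf H)$ is integrable, for every such setting and every $q>0$. 2. (Increment over the all-square setting at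 high SNR.) With $K$ and $N_0$ fixed, for every $\varepsilon>0$ there is $S>0$ such that for all $N_1,\dots,N_K\ge N_0$ and all $q>0$ for which both settings $(N_0,N_1,\dots,N_K)$ and $(N_0,N_0,\dots,N_0)$ have SNR at least $S$, the increment $$\Delta\tilde R=\tilde R(N_0,N_1,\dots,N_K;q)-\tilde R(N_0,N_0,\dots,N_0;q)$$ satisfies $$\Big|\Delta\tilde R-\sum_{k=1}^K\sum_{\ell=1}^{N_0}\big[\psi(N_k-\ell+1)-\psi(N_0-\ell+1)\big]\Big|<\varepsilon .$$ In particular, for a fixed setting, $\Delta\tilde R$ tends to this double sum as $q\to\infty$. 3. For all $N_1,\dots,N_K\ge N_0$, $$\sum_{k=1}^K\sum_{\ell=1}^{N_0}\big[\psi(N_k-\ell+1)-\psi(N_0-\ell+1)\big]=\sum_{k=1}^K\sum_{\ell=1}^{N_0}\sum_{s=N_0}^{N_k-1}\frac1{s-\ell+1}.$$ 4. (One additional antenna at high SNR.) With $K$ and $N_0$ fixed, for every $\varepsilon>0$ there is $S>0$ such that for all $N_1,\dots,N_K\ge N_0$, all $k\in\{1,\dots,K\}$ and all $q>0$ with $q\prod_{j=1}^K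 N_j\ge S$, $$\Big|\tilde R(N_0,\dots,N_{k-1},N_k+1,N_{k+1},\dots,N_K;q)-\tilde R(N_0,\dots,N_K;q)-\sum_{\ell=1}^{N_0}\frac1{N_k-\ell+1}\Big|<\varepsilon .$$ -/

import Mathlib

open MeasureTheory ProbabilityTheory Matrix
open scoped NNReal

noncomputable section

namespace RayleighProduct

/-- The circularly symmetric complex Gaussian law with mean zero and unit variance: real and
imaginary parts are independent, centred, of variance `1/2` (density `exp (-|z|²) / π`). -/
def complexGaussian : Measure ℂ :=
  ((gaussianReal 0 (1 / 2 : ℝ≥0)).prod (gaussianReal 0 (1 / 2 : ℝ≥0))).map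
    (fun p : ℝ × ℝ => (p.1 : ℂ) + (p.2 : ℂ) * Complex.I)

/-- The law of an `m × n` Rayleigh channel: the entries are i.i.d. with law `complexGaussian`. -/
def rayleighLaw (m n : ℕ) : Measure (Fin m → Fin n → ℂ) :=
  Measure.pi fun _ => Measure.pi fun _ => complexGaussian

/-- The factors of a Rayleigh product channel with sizes `N 0, N 1, …, N K` (the values of `N`
beyond `K` play no role). The entry with index `k : Fin K` is the `(k + 1)`-st factor
`Q_{k+1}`, of size `N (k + 1) × N k`. -/
abbrev Factors (K : ℕ) (N : ℕ → ℕ) : Type :=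
  (k : Fin K) → Fin (N (k + 1)) → Fin (N k) → ℂ

/-- The joint law of the factors: they are independent Rayleigh channels. -/
def factorsLaw (K : ℕ) (N : ℕ → ℕ) : Measure (Factors K N) :=
  Measure.pi fun k : Fin K => rayleighLaw (N (k + 1)) (N k)

/-- The product channel `H = Q_K * Q_{K-1} * ⋯ * Q_1`, of size `N K × N 0`. -/
def channel : (K : ℕ) → (N : ℕ → ℕ) → Factors K N → Matrix (Fin (N K)) (Fin (N 0)) ℂ
  | 0, _, _ => 1
  | K + 1, N, Q =>
      (Matrix.of (Q (Fin.last K)) : Matrix (Fin (N (K + 1))) (Fin (N K)) ℂ) *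
        channel K N (fun k => Q k.castSucc)

/-- The capacity `ln det (I + q Hᴴ H)` in nats per channel use, for given factors. The
determinant of this positive definite matrix is a positive real, read off by `re`. -/
def capacity (K : ℕ) (N : ℕ → ℕ) (q : ℝ) (Q : Factors K N) : ℝ :=
  Real.log (((1 : Matrix (Fin (N 0)) (Fin (N 0)) ℂ) +
    (q : ℂ) • ((channel K N Q)ᴴ * channel K N Q)).det).re

/-- The ergodic capacity: the mean of `capacity` over the random factors. -/
def ergodicCapacity (K : ℕ) (N : ℕ → ℕ) (q : ℝ) : ℝ :=
  ∫ Q, capacity K N q Q ∂(factorsLaw K N)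

/-- The signal-to-noise ratio `q * N 1 * ⋯ * N K`, which is the mean of each diagonal entry of
`q Hᴴ H`. -/
def snr (K : ℕ) (N : ℕ → ℕ) (q : ℝ) : ℝ :=
  q * ∏ k ∈ Finset.Icc 1 K, (N k : ℝ)

/-- The digamma function on the real line, `ψ = Γ' / Γ`. -/
def digamma (x : ℝ) : ℝ := (Complex.digamma (x : ℂ)).re

end RayleighProduct

end

noncomputable section

namespace RayleighProduct

/-! Put `G = Hᴴ H`, which is almost surely invertible. The factorisation `1 + q G = q G (1 + (q
G)⁻¹)` splits the capacity into `N₀ log q`, the term `log det G`, and a nonnegative remainder `log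
det (1 + (q G)⁻¹)`.

The mean of `log det G` is exact. If the product `A` of the inner factors has independent columns,
write `A = U R` with `U` an isometry. Then the Gram determinant of `Q A` is that of `Q U` times that
of `A`, and `Q U` is again a Rayleigh channel, of width `N₀`, whatever `A` is. So each tier
contributes an independent Wishart log-determinant (`map_log_gramDet_mul_sub`). Adjoining a Gaussian
column multiplies a Gram determinant by the squared distance of that column to the span of the
others, a Gamma variable (`map_gramDet_ratio`), whose mean logarithm is a digamma value.

The remainder is at most `2 N₀ √(tr G⁻¹ / q)`. The inverse trace is submultiplicative along `Q A =
(Q U) R`, and its half-order moment for one tier is `O(N_k ^ (-1/2))`. Hence the mean remainder is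
at most `C / √SNR` with `C` depending only on `K` and `N₀` (`capacity_expansion`), so one threshold
serves all sizes. The square root is essential: a square factor has an inverse trace of infinite
mean.

Subtracting two such expansions cancels `N₀ log q`; the recurrence of the digamma function then
telescopes the difference. -/

/-- The law of a vector with i.i.d. circularly symmetric complex Gaussian entries. -/
def gaussVec (d : ℕ) : Measure (Fin d → ℂ) := Measure.pi fun _ => complexGaussian

/-! ### Complex Gaussian vectors: characteristic functions and invariance -/

lemma measurable_ofReal_add_mul_I :
    Measurable (fun p : ℝ × ℝ => (p.1 : ℂ) + (p.2 : ℂ) * Complex.I) := by fun_prop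

instance : IsProbabilityMeasure complexGaussian :=
  Measure.isProbabilityMeasure_map measurable_ofReal_add_mul_I.aemeasurable

instance (d : ℕ) : IsProbabilityMeasure (gaussVec d) := by
  unfold gaussVec; infer_instance

instance (m n : ℕ) : IsProbabilityMeasure (rayleighLaw m n) := by
  unfold rayleighLaw; infer_instance

instance (K : ℕ) (N : ℕ → ℕ) : IsProbabilityMeasure (factorsLaw K N) := by
  unfold factorsLaw; infer_instance

lemma rayleighLaw_eq (m n : ℕ) : rayleighLaw m n = Measure.pi fun _ => gaussVec n := rfl

lemma charFun_complexGaussian (a : ℂ) :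
    ∫ z, Complex.exp (((star a * z).re : ℝ) * Complex.I) ∂complexGaussian =
      Complex.exp (-((‖a‖ ^ 2 / 4 : ℝ) : ℂ)) := by
  unfold complexGaussian
  rw [integral_map measurable_ofReal_add_mul_I.aemeasurable (by fun_prop)]
  have h : ∀ p : ℝ × ℝ, Complex.exp (((star a * ((p.1 : ℂ) + (p.2 : ℂ) * Complex.I)).re : ℝ) *
      Complex.I) = Complex.exp (a.re * p.1 * Complex.I) * Complex.exp (a.im * p.2 * Complex.I) := by
    intro p
    rw [← Complex.exp_add]
    congr 1
    simp
    ring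
  simp_rw [h]
  rw [integral_prod_mul (fun x : ℝ => Complex.exp (a.re * x * Complex.I))
    (fun y : ℝ => Complex.exp (a.im * y * Complex.I)), ← charFun_apply_real, ← charFun_apply_real,
    charFun_gaussianReal, charFun_gaussianReal, ← Complex.exp_add]
  congr 1
  rw [Complex.sq_norm, Complex.normSq_apply]
  push_cast
  simp
  ring

/-- A real-linear functional is determined by its values on the vectors `e_i` and `I e_i`; this
brings `charFunDual` into the form computed in `charFun_gaussVec`. -/
lemma strongDual_eq_dotProduct {d : ℕ} (L : StrongDual ℝ (Fin d → ℂ)) :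
    ∃ a : Fin d → ℂ, ∀ x, L x = (star a ⬝ᵥ x).re := by
  refine ⟨fun i => (L (Pi.single i 1) : ℂ) + (L (Pi.single i Complex.I) : ℂ) * Complex.I,
    fun x => ?_⟩
  have hx : x = ∑ i, ((x i).re • (Pi.single i 1 : Fin d → ℂ) +
      (x i).im • (Pi.single i Complex.I : Fin d → ℂ)) := by
    ext j
    simp [Finset.sum_apply, Pi.single_apply, Finset.sum_add_distrib, Complex.re_add_im]
  conv_lhs => rw [hx]
  simp [dotProduct, Complex.re_sum, mul_comm]

lemma charFun_gaussVec {d : ℕ} (a : Fin d → ℂ) :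
    ∫ x, Complex.exp (((star a ⬝ᵥ x).re : ℝ) * Complex.I) ∂(gaussVec d) =
      Complex.exp (-((∑ i, ‖a i‖ ^ 2 / 4 : ℝ) : ℂ)) := by
  have h : ∀ x : Fin d → ℂ, Complex.exp (((star a ⬝ᵥ x).re : ℝ) * Complex.I) =
      ∏ i, Complex.exp (((star (a i) * x i).re : ℝ) * Complex.I) := by
    intro x
    rw [← Complex.exp_sum, dotProduct, Complex.re_sum, Complex.ofReal_sum, Finset.sum_mul]
    rfl
  simp_rw [h, gaussVec]
  rw [integral_fintype_prod_eq_prod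
    (f := fun (i : Fin d) (z : ℂ) => Complex.exp (((star (a i) * z).re : ℝ) * Complex.I))]
  simp_rw [charFun_complexGaussian]
  rw [← Complex.exp_sum, Finset.sum_neg_distrib, Complex.ofReal_sum]

lemma sum_sq_norm_eq_dotProduct {d : ℕ} (a : Fin d → ℂ) :
    ((∑ i, ‖a i‖ ^ 2 : ℝ) : ℂ) = star a ⬝ᵥ a := by
  simp [dotProduct, ← Complex.conj_mul']

/-- A matrix with orthonormal rows maps standard Gaussian vectors to standard ones. -/
lemma map_mulVec_gaussVec {d m : ℕ} (U : Matrix (Fin d) (Fin m) ℂ) (hU : U * Uᴴ = 1) :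
    (gaussVec m).map (fun x => U *ᵥ x) = gaussVec d := by
  have hc : Continuous (fun x : Fin m → ℂ => U *ᵥ x) := by fun_prop
  have : IsProbabilityMeasure ((gaussVec m).map (fun x => U *ᵥ x)) :=
    Measure.isProbabilityMeasure_map hc.measurable.aemeasurable
  apply Measure.ext_of_charFunDual
  ext L
  obtain ⟨a, ha⟩ := strongDual_eq_dotProduct L
  simp_rw [charFunDual_apply, ha]
  rw [integral_map hc.measurable.aemeasurable (by fun_prop)]
  have h1 : ∀ x, star a ⬝ᵥ (U *ᵥ x) = star (Uᴴ *ᵥ a) ⬝ᵥ x := by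
    intro x
    rw [star_mulVec, conjTranspose_conjTranspose, dotProduct_mulVec]
  simp_rw [h1, charFun_gaussVec]
  congr 3
  rw [← Finset.sum_div, ← Finset.sum_div]
  congr 1
  -- The characteristic function depends on `a` only through its norm, and `Uᴴ` preserves norms
  -- because `U * Uᴴ = 1`.
  have := sum_sq_norm_eq_dotProduct (Uᴴ *ᵥ a)
  rw [star_mulVec, conjTranspose_conjTranspose, ← dotProduct_mulVec, mulVec_mulVec, hU,
    one_mulVec, ← sum_sq_norm_eq_dotProduct] at this
  exact_mod_cast this

/-- Lets a channel be treated as a family of independent columns, the form in which columns are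
removed one at a time. -/
lemma map_swap_rayleighLaw (m n : ℕ) :
    (rayleighLaw m n).map (fun Q j i => Q i j) = rayleighLaw n m := by
  have key : ∀ a b : ℕ, (Measure.pi fun _ : Fin a × Fin b => complexGaussian).map
      (MeasurableEquiv.curry (Fin a) (Fin b) ℂ) = rayleighLaw a b := by
    intro a b
    have := Measure.infinitePi_map_curry (fun (_ : Fin a) (_ : Fin b) => complexGaussian)
    simpa only [Measure.infinitePi_eq_pi, rayleighLaw] using this
  have hsw : (Measure.pi fun _ : Fin m × Fin n => complexGaussian).map
      (MeasurableEquiv.piCongrLeft (fun _ => ℂ) (Equiv.prodComm (Fin m) (Fin n))) =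
      Measure.pi fun _ : Fin n × Fin m => complexGaussian :=
    Measure.pi_map_piCongrLeft (Equiv.prodComm (Fin m) (Fin n))
      (fun _ : Fin n × Fin m => complexGaussian)
  have hmeas : Measurable (fun (Q : Fin m → Fin n → ℂ) j i => Q i j) := by fun_prop
  rw [← key m n, ← key n m, ← hsw, Measure.map_map hmeas (MeasurableEquiv.measurable _),
    Measure.map_map (MeasurableEquiv.measurable _) (MeasurableEquiv.measurable _)]
  congr 1

/-- If the conditional law given the second coordinate is almost surely constant, it is the
unconditional law. -/
lemma map_prod_eq_of_ae_map_eq {α β γ : Type*} [MeasurableSpace α] [MeasurableSpace β]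
    [MeasurableSpace γ] {μ : Measure α} {ν : Measure β} [SFinite μ] [IsProbabilityMeasure ν]
    {ρ : Measure γ} {F : α × β → γ} (hF : Measurable F)
    (h : ∀ᵐ b ∂ν, μ.map (fun a => F (a, b)) = ρ) : (μ.prod ν).map F = ρ := by
  ext s hs
  rw [Measure.map_apply hF hs, Measure.prod_apply_symm (hF hs)]
  have : ∀ᵐ b ∂ν, μ ((fun a => (a, b)) ⁻¹' (F ⁻¹' s)) = ρ s := by
    filter_upwards [h] with b hb
    have hm : Measurable fun a => F (a, b) := hF.comp measurable_prodMk_right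
    rw [← hb, Measure.map_apply hm hs]
    rfl
  rw [lintegral_congr_ae this]
  simp

/-! ### The Gamma law: squared norms, mean logarithm, half-order inverse moment -/

section GammaLaw

open Set Filter Topology

/-- Repeated integration by parts. The parameter is complex because the characteristic function of
the Gamma law needs `s = 1 - t * I`. -/
lemma integral_pow_mul_cexp_neg (n : ℕ) {s : ℂ} (hs : 0 < s.re) :
    IntegrableOn (fun t : ℝ => (t : ℂ) ^ n * Complex.exp (-s * t)) (Ioi 0) ∧
    ∫ t in Ioi (0 : ℝ), (t : ℂ) ^ n * Complex.exp (-s * t) = n.factorial / s ^ (n + 1) := by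
  have hs0 : s ≠ 0 := by
    rintro rfl
    simp at hs
  have hnorm : ∀ (n : ℕ) (t : ℝ), 0 < t → ‖(t : ℂ) ^ n * Complex.exp (-s * t)‖ =
      t ^ n * Real.exp (-s.re * t) := by
    intro n t ht
    rw [norm_mul, norm_pow, Complex.norm_exp]
    simp [abs_of_pos ht]
  have hint : ∀ n : ℕ, IntegrableOn (fun t : ℝ => (t : ℂ) ^ n * Complex.exp (-s * t)) (Ioi 0) := by
    intro n
    have h := integrableOn_rpow_mul_exp_neg_mul_rpow (s := n) (p := 1) (b := s.re)
      (by have : (0 : ℝ) ≤ n := n.cast_nonneg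
          linarith) one_pos hs
    refine h.mono' (by fun_prop) ?_
    filter_upwards [self_mem_ae_restrict measurableSet_Ioi] with t ht
    rw [hnorm n t ht]
    simp
  refine ⟨hint n, ?_⟩
  induction n with
  | zero =>
    simp only [pow_zero, one_mul, Nat.factorial_zero, Nat.cast_one, zero_add, pow_one]
    rw [integral_exp_mul_complex_Ioi (by simpa using hs)]
    simp
  | succ n ih =>
    have hderiv : ∀ t ∈ Ici (0 : ℝ), HasDerivAt
        (fun t : ℝ => (t : ℂ) ^ (n + 1) * Complex.exp (-s * t))
        ((n + 1 : ℕ) * ((t : ℂ) ^ n * Complex.exp (-s * t)) -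
          s * ((t : ℂ) ^ (n + 1) * Complex.exp (-s * t))) t := by
      intro t _
      have h1 : HasDerivAt (fun z : ℂ => z ^ (n + 1) * Complex.exp (-s * z))
          ((n + 1 : ℕ) * ((t : ℂ) ^ n * Complex.exp (-s * t)) -
          s * ((t : ℂ) ^ (n + 1) * Complex.exp (-s * t))) (t : ℂ) := by
        have := (hasDerivAt_pow (n + 1) (t : ℂ)).mul
          (((hasDerivAt_id (t : ℂ)).const_mul (-s)).cexp)
        convert! this using 1
        simp
        ring
      exact h1.comp_ofReal
    have hlim : Tendsto (fun t : ℝ => (t : ℂ) ^ (n + 1) * Complex.exp (-s * t)) atTop (𝓝 0) := by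
      rw [tendsto_zero_iff_norm_tendsto_zero]
      have h := tendsto_rpow_mul_exp_neg_mul_atTop_nhds_zero (n + 1 : ℕ) s.re hs
      refine h.congr' ?_
      filter_upwards [eventually_gt_atTop 0] with t ht
      rw [hnorm _ t ht, Real.rpow_natCast]
    have h := integral_Ioi_of_hasDerivAt_of_tendsto' hderiv
      (((hint n).const_mul _).sub ((hint (n + 1)).const_mul _)) hlim
    rw [integral_sub ((hint n).const_mul _) ((hint (n + 1)).const_mul _),
      integral_const_mul, integral_const_mul, ih] at h
    simp only [Complex.ofReal_zero, ne_eq, Nat.add_eq_zero_iff, one_ne_zero, and_false,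
      not_false_eq_true, zero_pow, zero_mul, sub_zero] at h
    have h2 := (sub_eq_zero.mp h).symm
    rw [eq_div_iff (by positivity), pow_succ s (n + 1), Nat.factorial_succ]
    rw [← mul_div_assoc, eq_div_iff (by positivity)] at h2
    push_cast at h2 ⊢
    rw [← h2]
    ring

lemma integral_gammaMeasure {E : Type*} [NormedAddCommGroup E] [NormedSpace ℝ E] {a : ℝ}
    (ha : 0 < a) (f : ℝ → E) :
    ∫ x, f x ∂(gammaMeasure a 1) =
      ∫ x in Ioi 0, (x ^ (a - 1) * Real.exp (-x) / Real.Gamma a) • f x := by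
  unfold gammaMeasure gammaPDF
  rw [integral_withDensity_eq_integral_toReal_smul (by fun_prop) (by simp)]
  rw [← setIntegral_eq_integral_of_ae_compl_eq_zero (s := Ioi 0)]
  · refine setIntegral_congr_fun measurableSet_Ioi fun x (hx : 0 < x) => ?_
    simp only [ENNReal.toReal_ofReal (gammaPDFReal_nonneg ha one_pos x)]
    simp [gammaPDFReal, hx.le]
    congr 1
    ring
  · have h0 : ∀ᵐ x : ℝ, x ≠ 0 := by simp [ae_iff, measure_singleton]
    filter_upwards [h0] with x hx hx'
    have : ¬ 0 ≤ x := fun h => hx' (lt_of_le_of_ne h (Ne.symm hx))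
    simp [gammaPDFReal, this]

lemma ae_gammaMeasure_pos (a : ℝ) : ∀ᵐ x ∂(gammaMeasure a 1), 0 < x := by
  unfold gammaMeasure
  rw [ae_withDensity_iff (by unfold gammaPDF; fun_prop)]
  have h0 : ∀ᵐ x : ℝ, x ≠ 0 := by simp [ae_iff, measure_singleton]
  filter_upwards [h0] with x hx hx'
  by_contra h
  exact hx' (gammaPDF_of_neg (lt_of_le_of_ne (not_lt.mp h) hx))

lemma charFun_gammaMeasure (d : ℕ) (hd : 1 ≤ d) (t : ℝ) :
    charFun (gammaMeasure d 1) t = 1 / (1 - t * Complex.I) ^ d := by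
  obtain ⟨n, rfl⟩ : ∃ n, d = n + 1 := ⟨d - 1, by omega⟩
  rw [charFun_apply_real, integral_gammaMeasure (by positivity)]
  have := (integral_pow_mul_cexp_neg n (s := 1 - t * Complex.I) (by simp)).2
  have hfac : Real.Gamma ((n + 1 : ℕ) : ℝ) = n.factorial := by
    push_cast
    exact Real.Gamma_nat_eq_factorial n
  have hne : ((n.factorial : ℕ) : ℂ) ≠ 0 := by exact_mod_cast n.factorial_ne_zero
  calc _ = ∫ x in Ioi (0 : ℝ), (1 / (n.factorial : ℂ)) *
          ((x : ℂ) ^ n * Complex.exp (-(1 - t * Complex.I) * x)) := by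
        refine setIntegral_congr_fun measurableSet_Ioi fun x (hx : 0 < x) => ?_
        simp only [Complex.real_smul, hfac]
        have : -(1 - t * Complex.I) * (x : ℂ) = ((-x : ℝ) : ℂ) + t * x * Complex.I := by
          push_cast; ring
        rw [this, Complex.exp_add, ← Complex.ofReal_exp]
        push_cast
        simp only [add_sub_cancel_right, Real.rpow_natCast]
        push_cast
        ring
    _ = _ := by
        rw [integral_const_mul, this]
        field_simp

/-- Real and imaginary parts each contribute a Gaussian integral proportional to `(1 - t * I) ^
(-1/2)`; multiplying the two removes the square root. -/
lemma charFun_normSq_complexGaussian (t : ℝ) :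
    ∫ z, Complex.exp (t * ((‖z‖ ^ 2 : ℝ) : ℂ) * Complex.I) ∂complexGaussian =
      1 / (1 - t * Complex.I) := by
  have hre : ∫ x : ℝ, Complex.exp (t * x ^ 2 * Complex.I) ∂(gaussianReal 0 (1 / 2 : ℝ≥0)) =
      (1 / Real.sqrt Real.pi) * (Real.pi / (1 - t * Complex.I)) ^ (1 / 2 : ℂ) := by
    rw [integral_gaussianReal_eq_integral_smul (by norm_num)]
    rw [← integral_gaussian_complex (b := 1 - t * Complex.I) (by simp), ← integral_const_mul]
    congr 1
    ext x
    simp only [gaussianPDFReal, Complex.real_smul]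
    have : -(1 - t * Complex.I) * (x : ℂ) ^ 2 =
        ((-x ^ 2 : ℝ) : ℂ) + t * x ^ 2 * Complex.I := by
      push_cast; ring
    rw [this, Complex.exp_add, ← Complex.ofReal_exp]
    have h2 : ((Real.sqrt 2 : ℝ) : ℂ) ≠ 0 := by
      exact_mod_cast (Real.sqrt_pos.mpr two_pos).ne'
    push_cast
    simp
    field_simp
  unfold complexGaussian
  rw [integral_map measurable_ofReal_add_mul_I.aemeasurable (by fun_prop)]
  have h : ∀ p : ℝ × ℝ,
      Complex.exp (t * ((‖(p.1 : ℂ) + (p.2 : ℂ) * Complex.I‖ ^ 2 : ℝ) : ℂ) * Complex.I) =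
      Complex.exp (t * p.1 ^ 2 * Complex.I) * Complex.exp (t * p.2 ^ 2 * Complex.I) := by
    intro p
    rw [← Complex.exp_add]
    congr 1
    rw [Complex.sq_norm, Complex.normSq_apply]
    simp
    ring
  simp_rw [h]
  rw [integral_prod_mul (fun x : ℝ => Complex.exp (t * x ^ 2 * Complex.I))
    (fun y : ℝ => Complex.exp (t * y ^ 2 * Complex.I)), hre]
  have hpi : (Real.pi : ℂ) ≠ 0 := by exact_mod_cast Real.pi_ne_zero
  have hb : (1 - t * Complex.I) ≠ 0 := by
    intro h0
    have := congrArg Complex.re h0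
    simp at this
  have hsq : ((Real.sqrt Real.pi : ℝ) : ℂ) * ((Real.sqrt Real.pi : ℝ) : ℂ) = Real.pi := by
    rw [← Complex.ofReal_mul, Real.mul_self_sqrt Real.pi_pos.le]
  rw [mul_mul_mul_comm, ← Complex.cpow_add _ _ (div_ne_zero hpi hb)]
  norm_num
  rw [← mul_inv, hsq]
  field_simp

/-- The squared norm of a standard complex Gaussian vector in dimension `d` is `Gamma(d, 1)`. -/
lemma map_normSq_gaussVec (d : ℕ) (hd : 1 ≤ d) :
    (gaussVec d).map (fun x => ∑ i, ‖x i‖ ^ 2) = gammaMeasure d 1 := by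
  have hc : Continuous (fun x : Fin d → ℂ => ∑ i, ‖x i‖ ^ 2) := by fun_prop
  have : IsProbabilityMeasure ((gaussVec d).map (fun x => ∑ i, ‖x i‖ ^ 2)) :=
    Measure.isProbabilityMeasure_map hc.measurable.aemeasurable
  have : IsProbabilityMeasure (gammaMeasure d 1) :=
    isProbabilityMeasure_gammaMeasure (by positivity) one_pos
  apply Measure.ext_of_charFun
  ext t
  rw [charFun_gammaMeasure d hd, charFun_apply_real,
    integral_map hc.measurable.aemeasurable (by fun_prop)]
  have h : ∀ x : Fin d → ℂ, Complex.exp (t * ((∑ i, ‖x i‖ ^ 2 : ℝ) : ℂ) * Complex.I) =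
      ∏ i, Complex.exp (t * ((‖x i‖ ^ 2 : ℝ) : ℂ) * Complex.I) := by
    intro x
    rw [← Complex.exp_sum, Complex.ofReal_sum, Finset.mul_sum, Finset.sum_mul]
  simp_rw [h, gaussVec]
  rw [integral_fintype_prod_eq_pow
    (fun z : ℂ => Complex.exp (t * ((‖z‖ ^ 2 : ℝ) : ℂ) * Complex.I)),
    charFun_normSq_complexGaussian]
  simp

lemma integrable_log_gammaMeasure (d : ℕ) (hd : 1 ≤ d) :
    Integrable Real.log (gammaMeasure d 1) := by
  have hd' : (0 : ℝ) < d := by exact_mod_cast hd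
  have hm : MellinConvergent (fun t : ℝ => Real.log t • ((Real.exp (-t) : ℝ) : ℂ)) (d : ℂ) := by
    -- Differentiating the Mellin transform of `exp (-t)` produces the logarithm. The exponential is
    -- bounded at `0` and decays faster than any power, so any `a > d` would do.
    refine (mellin_hasDerivAt_of_isBigO_rpow (E := ℂ) (a := d + 1) (b := 0) ?_ ?_ (by simp) ?_
      (by simpa using hd')).1
    · exact (Continuous.continuousOn (by fun_prop)).locallyIntegrableOn measurableSet_Ioi
    · rw [← Asymptotics.isBigO_norm_left]
      simp_rw [Complex.norm_real, Asymptotics.isBigO_norm_left]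
      simpa only [neg_one_mul] using (isLittleO_exp_neg_mul_rpow_atTop zero_lt_one _).isBigO
    · simp_rw [neg_zero, Real.rpow_zero]
      refine Asymptotics.isBigO_const_of_tendsto (y := (1 : ℂ)) ?_ one_ne_zero
      have : Continuous fun t : ℝ => ((Real.exp (-t) : ℝ) : ℂ) := by fun_prop
      simpa using (this.tendsto 0).mono_left nhdsWithin_le_nhds
  unfold gammaMeasure gammaPDF
  rw [integrable_withDensity_iff_integrable_smul' (by fun_prop) (by simp)]
  rw [← integrableOn_iff_integrable_of_support_subset (s := Ioi 0)]
  · refine (hm.norm.const_mul (1 / Real.Gamma d)).mono' (by fun_prop) ?_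
    filter_upwards [self_mem_ae_restrict measurableSet_Ioi] with x hx
    have hx : 0 < x := hx
    have hG := Real.Gamma_pos_of_pos hd'
    rw [ENNReal.toReal_ofReal (gammaPDFReal_nonneg hd' one_pos x)]
    have h1 : ‖(x : ℂ) ^ ((d : ℂ) - 1)‖ = x ^ ((d : ℝ) - 1) := by
      rw [Complex.norm_cpow_eq_rpow_re_of_pos hx]
      simp
    simp only [norm_smul, h1, Complex.norm_real, Real.norm_eq_abs, abs_of_pos (Real.exp_pos _),
      abs_of_nonneg (gammaPDFReal_nonneg hd' one_pos x)]
    simp only [gammaPDFReal, hx.le, if_true, Real.one_rpow, one_mul]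
    exact le_of_eq (by ring)
  · intro x hx
    by_contra h
    have h : x ≤ 0 := not_lt.mp h
    rcases h.lt_or_eq with h | h
    · simp [gammaPDFReal, not_le.mpr h] at hx
    -- At `0` the integrand vanishes because `Real.log 0 = 0`.
    · simp [h] at hx

/-- Differentiating Euler's integral under the integral sign gives `Γ'(d)` as the integral of `t ^
(d - 1) * log t * exp (-t)`; dividing by `Γ(d)` yields the mean. -/
lemma integral_log_gammaMeasure (d : ℕ) (hd : 1 ≤ d) :
    ∫ x, Real.log x ∂(gammaMeasure d 1) = digamma d := by
  have hd' : (0 : ℝ) < d := by exact_mod_cast hd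
  have hG := Real.Gamma_pos_of_pos hd'
  have hΓ : HasDerivAt Complex.Gamma
      (∫ t : ℝ in Ioi 0, (t : ℂ) ^ ((d : ℂ) - 1) * (Real.log t * Real.exp (-t))) d := by
    refine (Complex.hasDerivAt_GammaIntegral (by simpa using hd')).congr_of_eventuallyEq ?_
    have : {s : ℂ | 0 < s.re} ∈ 𝓝 (d : ℂ) :=
      (isOpen_lt continuous_const Complex.continuous_re).mem_nhds (by simpa using hd')
    filter_upwards [this] with s hs
    exact Complex.Gamma_eq_integral hs
  have hcast : (∫ t : ℝ in Ioi 0, (t : ℂ) ^ ((d : ℂ) - 1) * (Real.log t * Real.exp (-t))) =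
      ((∫ t : ℝ in Ioi 0, t ^ ((d : ℝ) - 1) * (Real.log t * Real.exp (-t)) : ℝ) : ℂ) := by
    rw [← integral_complex_ofReal]
    refine setIntegral_congr_fun measurableSet_Ioi fun x (hx : 0 < x) => ?_
    simp only [Complex.ofReal_mul, Complex.ofReal_cpow hx.le]
    push_cast
    rfl
  rw [digamma, Complex.digamma_def, logDeriv_apply, Complex.ofReal_natCast, hΓ.deriv, hcast]
  have : Complex.Gamma d = ((Real.Gamma d : ℝ) : ℂ) := by
    rw [← Complex.Gamma_ofReal, Complex.ofReal_natCast]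
  rw [this, ← Complex.ofReal_div, Complex.ofReal_re, integral_gammaMeasure hd', ← integral_div]
  refine setIntegral_congr_fun measurableSet_Ioi fun x (hx : 0 < x) => ?_
  simp only [smul_eq_mul]
  ring

/-- Log-convexity of `Γ` at the midpoint of `d` and `d + 1` bounds `Γ(d + 1/2)` by `Γ(d) √d`; the
recurrence then shifts down by one. -/
lemma Gamma_sub_half_div_Gamma_le (d : ℝ) (hd : 1 ≤ d) :
    Real.Gamma (d - 1 / 2) / Real.Gamma d ≤ 2 / Real.sqrt d := by
  have hd0 : 0 < d := by linarith
  have hG := Real.Gamma_pos_of_pos hd0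
  have hs := Real.sqrt_pos.mpr hd0
  have h1 : Real.Gamma (d + 1 / 2) = (d - 1 / 2) * Real.Gamma (d - 1 / 2) := by
    rw [← Real.Gamma_add_one (by linarith)]
    congr 1
    ring
  have h2 := Real.Gamma_mul_add_mul_le_rpow_Gamma_mul_rpow_Gamma (s := d) (t := d + 1)
    (a := 1 / 2) (b := 1 / 2) hd0 (by linarith) (by norm_num) (by norm_num) (by norm_num)
  have h3 : Real.Gamma (d + 1 / 2) ≤ Real.Gamma d * Real.sqrt d := by
    rw [show (1 / 2 * d + 1 / 2 * (d + 1) : ℝ) = d + 1 / 2 by ring] at h2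
    refine h2.trans (le_of_eq ?_)
    rw [Real.Gamma_add_one hd0.ne', ← Real.sqrt_eq_rpow, ← Real.sqrt_eq_rpow,
      Real.sqrt_mul hd0.le, mul_left_comm, Real.mul_self_sqrt hG.le, mul_comm]
  rw [div_le_div_iff₀ hG hs]
  have hsq := Real.mul_self_sqrt hd0.le
  have hp : 0 < Real.Gamma (d - 1 / 2) := Real.Gamma_pos_of_pos (by linarith)
  rw [h1] at h3
  -- The factor `2` comes from `d ≤ 2 (d - 1/2)`, valid since `1 ≤ d`.
  have h4 : d * Real.Gamma (d - 1 / 2) ≤ 2 * (Real.Gamma d * Real.sqrt d) := by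
    nlinarith
  have h5 : (Real.Gamma (d - 1 / 2) * Real.sqrt d) * Real.sqrt d ≤
      (2 * Real.Gamma d) * Real.sqrt d := by
    calc _ = d * Real.Gamma (d - 1 / 2) := by rw [mul_assoc, hsq, mul_comm]
      _ ≤ _ := h4
      _ = _ := by ring
  exact le_of_mul_le_mul_right h5 hs

/-- The inverse square root of a `Gamma(d, 1)` variable has mean at most `2 / √d`. -/
lemma lintegral_inv_sqrt_gammaMeasure_le (d : ℕ) (hd : 1 ≤ d) :
    ∫⁻ x, ENNReal.ofReal (Real.sqrt x⁻¹) ∂(gammaMeasure d 1) ≤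
      ENNReal.ofReal (2 / Real.sqrt d) := by
  have hd1 : (1 : ℝ) ≤ d := by exact_mod_cast hd
  have hd' : (0 : ℝ) < d := by linarith
  have hG := Real.Gamma_pos_of_pos hd'
  have hp : 0 < Real.Gamma ((d : ℝ) - 1 / 2) := Real.Gamma_pos_of_pos (by linarith)
  have hmeas : ∀ a : ℝ, Measurable (gammaPDF a 1) := fun a => by unfold gammaPDF; fun_prop
  unfold gammaMeasure
  rw [lintegral_withDensity_eq_lintegral_mul _ (hmeas _) (by fun_prop)]
  have h0 : ∀ᵐ x : ℝ, x ≠ 0 := by simp [ae_iff, measure_singleton]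
  -- Multiplying the density by `x ^ (-1/2)` lowers the shape parameter by `1/2`, up to the ratio of
  -- normalising constants.
  have h : ∀ᵐ x : ℝ, (gammaPDF d 1 * fun x => ENNReal.ofReal (Real.sqrt x⁻¹)) x =
      ENNReal.ofReal (Real.Gamma ((d : ℝ) - 1 / 2) / Real.Gamma d) *
        gammaPDF ((d : ℝ) - 1 / 2) 1 x := by
    filter_upwards [h0] with x hx
    rw [Pi.mul_apply]
    rcases lt_or_gt_of_ne hx with hx | hx
    · simp [gammaPDF_of_neg hx]
    · rw [gammaPDF_of_nonneg hx.le, gammaPDF_of_nonneg hx.le, ← ENNReal.ofReal_mul (by positivity),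
        ← ENNReal.ofReal_mul (by positivity)]
      congr 1
      have : x ^ ((d : ℝ) - 1 / 2 - 1) = x ^ ((d : ℝ) - 1) * Real.sqrt x⁻¹ := by
        rw [Real.sqrt_eq_rpow, Real.inv_rpow hx.le, ← Real.rpow_neg hx.le, ← Real.rpow_add hx]
        congr 1
        ring
      rw [this]
      generalize Real.Gamma ((d : ℝ) - 1 / 2) = g at hp ⊢
      simp
      field_simp
  rw [lintegral_congr_ae h, lintegral_const_mul _ (hmeas _),
    lintegral_gammaPDF_eq_one (by linarith) one_pos, mul_one]
  exact ENNReal.ofReal_le_ofReal (Gamma_sub_half_div_Gamma_le _ hd1)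

end GammaLaw

/-! ### Gram determinants, inverse traces and log-determinant bounds -/

section GramMatrix

open scoped ComplexOrder

/-- The Gram determinant `det (Aᴴ A)`. -/
def gramDet {m n : ℕ} (A : Matrix (Fin m) (Fin n) ℂ) : ℝ := (Aᴴ * A).det.re

/-- The trace of the inverse of the Gram matrix `Aᴴ A`. -/
def gramInvTrace {m n : ℕ} (A : Matrix (Fin m) (Fin n) ℂ) : ℝ := ((Aᴴ * A)⁻¹).trace.re

section LinearAlgebra

variable {m n : ℕ}

lemma ofReal_gramDet (A : Matrix (Fin m) (Fin n) ℂ) : ((gramDet A : ℝ) : ℂ) = (Aᴴ * A).det := by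
  have h := (posSemidef_conjTranspose_mul_self A).det_nonneg
  exact (Complex.eq_re_of_ofReal_le (r := 0) (by simpa using h)).symm

lemma gramDet_nonneg (A : Matrix (Fin m) (Fin n) ℂ) : 0 ≤ gramDet A := by
  have h := (posSemidef_conjTranspose_mul_self A).det_nonneg
  exact (Complex.le_def.mp h).1

lemma det_ne_zero_of_gramDet_ne_zero {A : Matrix (Fin m) (Fin n) ℂ} (h : gramDet A ≠ 0) :
    (Aᴴ * A).det ≠ 0 := by
  rw [← ofReal_gramDet]
  exact_mod_cast h

/-- The rows of `V` are the conjugates of an orthonormal basis of the kernel of `Bᴴ`, the orthogonal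
complement of the column span of `B`. The second identity decomposes the identity into the two
orthogonal projections. -/
lemma exists_orthogonal_coisometry (B : Matrix (Fin m) (Fin n) ℂ) (hB : gramDet B ≠ 0) :
    ∃ V : Matrix (Fin (m - n)) (Fin m) ℂ, V * Vᴴ = 1 ∧ Vᴴ * V + B * (Bᴴ * B)⁻¹ * Bᴴ = 1 := by
  have hdet := (det_ne_zero_of_gramDet_ne_zero hB).isUnit
  set f := Matrix.toEuclideanLin (𝕜 := ℂ) Bᴴ with hf
  have hsurj : Function.Surjective f := by
    intro y
    refine ⟨WithLp.toLp 2 ((B * (Bᴴ * B)⁻¹) *ᵥ y.ofLp), ?_⟩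
    rw [hf]
    simp only [Matrix.toLpLin_toLp]
    rw [toLin'_apply, mulVec_mulVec, ← Matrix.mul_assoc, mul_nonsing_inv _ hdet, one_mulVec]
  have hfr : Module.finrank ℂ (LinearMap.ker f) = m - n := by
    have h1 := f.finrank_range_add_finrank_ker
    rw [LinearMap.range_eq_top.mpr hsurj, finrank_top] at h1
    simp only [finrank_euclideanSpace, Fintype.card_fin] at h1
    omega
  have hle : n ≤ m := by
    have h1 := LinearMap.finrank_le_finrank_of_surjective hsurj
    simpa using h1
  let b := (stdOrthonormalBasis ℂ (LinearMap.ker f)).reindex (finCongr hfr)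
  let V : Matrix (Fin (m - n)) (Fin m) ℂ :=
    Matrix.of fun i k => star ((b i : EuclideanSpace ℂ (Fin m)) k)
  have hV : V * Vᴴ = 1 := by
    ext i j
    have h := orthonormal_iff_ite.mp b.orthonormal i j
    rw [Matrix.one_apply, mul_apply, ← h]
    simp only [Submodule.coe_inner, PiLp.inner_apply, V]
    simp [mul_comm]
  have hVB : Bᴴ * Vᴴ = 0 := by
    ext i j
    have h : f (b j) = 0 := (b j).2
    have h2 : Bᴴ *ᵥ ((b j : EuclideanSpace ℂ (Fin m)).ofLp) = 0 := congrArg WithLp.ofLp h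
    have h3 := congrFun h2 i
    simpa only [V, mul_apply, conjTranspose_apply, of_apply, star_star, mulVec, dotProduct,
      Matrix.zero_apply, Pi.zero_apply] using h3
  refine ⟨V, hV, ?_⟩
  have hVB' : V * B = 0 := by
    have := congrArg conjTranspose hVB
    simpa using this
  -- The stacked matrices are square since `n + (m - n) = m`, so this one-sided inverse is
  -- two-sided; the reversed product is the projection identity.
  have h1 : fromRows Bᴴ V * fromCols (B * (Bᴴ * B)⁻¹) Vᴴ = 1 := by
    rw [fromRows_mul_fromCols, hV, hVB, ← Matrix.mul_assoc, ← Matrix.mul_assoc,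
      mul_nonsing_inv _ hdet, hVB', Matrix.zero_mul, fromBlocks_one]
  have hcard : Fintype.card (Fin n ⊕ Fin (m - n)) = Fintype.card (Fin m) := by
    simp
    omega
  have h2 := (mul_eq_one_comm_of_card_eq _ _ _ hcard).mp h1
  rw [fromCols_mul_fromRows] at h2
  rw [add_comm]
  exact h2

lemma trace_conjTranspose_mul_self_re {k l : ℕ} (X : Matrix (Fin k) (Fin l) ℂ) :
    (Xᴴ * X).trace.re = ∑ j, ∑ i, ‖X i j‖ ^ 2 := by
  simp only [trace, diag, mul_apply, conjTranspose_apply, Complex.re_sum]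
  refine Finset.sum_congr rfl fun j _ => Finset.sum_congr rfl fun i _ => ?_
  rw [Complex.star_def, ← Complex.normSq_eq_conj_mul_self, Complex.ofReal_re, Complex.sq_norm]

/-- Adding a column multiplies the Gram determinant by its squared distance to the span of the
other columns. -/
lemma gramDet_eq_mul_sum_normSq (A : Matrix (Fin m) (Fin (n + 1)) ℂ) (j : Fin (n + 1))
    (V : Matrix (Fin (m - n)) (Fin m) ℂ)
    (hV : Vᴴ * V + (A.submatrix id j.succAbove) * ((A.submatrix id j.succAbove)ᴴ *
      (A.submatrix id j.succAbove))⁻¹ * (A.submatrix id j.succAbove)ᴴ = 1)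
    (hB : gramDet (A.submatrix id j.succAbove) ≠ 0) :
    gramDet A = gramDet (A.submatrix id j.succAbove) * ∑ i, ‖(V *ᵥ fun k => A k j) i‖ ^ 2 := by
  set B := A.submatrix id j.succAbove with hBdef
  have hdet := det_ne_zero_of_gramDet_ne_zero hB
  let a : Matrix (Fin m) (Fin 1) ℂ := A.submatrix id (fun _ => j)
  let e : Fin n ⊕ Fin 1 ≃ Fin (n + 1) :=
    (Equiv.sumCongr (Equiv.refl _) (Equiv.ofUnique (Fin 1) PUnit.{1})).trans
      ((Equiv.optionEquivSumPUnit (Fin n)).symm.trans (finSuccEquiv' j).symm)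
  have he : A.submatrix id e = fromCols B a := by
    ext i (k | k)
    · simp [e, B]
    · simp [e, a]
  have h1 : (Aᴴ * A).submatrix e e = fromBlocks (Bᴴ * B) (Bᴴ * a) (aᴴ * B) (aᴴ * a) := by
    rw [← fromRows_mul_fromCols, ← conjTranspose_fromCols_eq_fromRows_conjTranspose, ← he]
    rfl
  have : Invertible (Bᴴ * B) := Matrix.invertibleOfIsUnitDet _ hdet.isUnit
  have h2 : (Aᴴ * A).det = (Bᴴ * B).det * ((V * a)ᴴ * (V * a)).trace := by
    rw [← det_submatrix_equiv_self e, h1, det_fromBlocks₁₁, invOf_eq_nonsing_inv]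
    congr 1
    -- The Schur complement of `Bᴴ * B` is the squared length of the component of `a` orthogonal to
    -- the columns of `B`.
    have h3 : aᴴ * a - aᴴ * B * (Bᴴ * B)⁻¹ * (Bᴴ * a) = (V * a)ᴴ * (V * a) := by
      have : aᴴ * (Vᴴ * V + B * (Bᴴ * B)⁻¹ * Bᴴ) * a = aᴴ * a := by
        rw [hV, Matrix.mul_one]
      rw [← this, conjTranspose_mul]
      simp only [Matrix.mul_add, Matrix.add_mul, Matrix.mul_assoc]
      abel
    rw [h3, det_fin_one, trace_fin_one]
  unfold gramDet
  rw [h2, ← ofReal_gramDet B, Complex.re_ofReal_mul, Complex.ofReal_re,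
    trace_conjTranspose_mul_self_re, Fin.sum_univ_one]
  rfl

/-- The trace of the inverse Gram matrix in terms of deletions of columns. -/
lemma gramInvTrace_eq_sum (A : Matrix (Fin m) (Fin (n + 1)) ℂ) :
    gramInvTrace A = ∑ j : Fin (n + 1), (gramDet A / gramDet (A.submatrix id j.succAbove))⁻¹ := by
  unfold gramInvTrace
  rw [inv_def, trace_smul, Ring.inverse_eq_inv', ← ofReal_gramDet, ← Complex.ofReal_inv,
    smul_eq_mul, Complex.re_ofReal_mul, trace, Complex.re_sum, Finset.mul_sum]
  refine Finset.sum_congr rfl fun j _ => ?_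
  rw [diag_apply, adjugate_fin_succ_eq_det_submatrix, Even.neg_one_pow (by simp), one_mul,
    inv_div, div_eq_inv_mul]
  rfl

lemma gramInvTrace_nonneg (A : Matrix (Fin m) (Fin n) ℂ) : 0 ≤ gramInvTrace A :=
  (Complex.le_def.mp (posSemidef_conjTranspose_mul_self A).inv.trace_nonneg).1

/-- Submultiplicativity of the Frobenius norm, by Cauchy–Schwarz on each entry. -/
lemma sum_normSq_mul_le {k l p : ℕ} (X : Matrix (Fin k) (Fin l) ℂ) (Y : Matrix (Fin l) (Fin p) ℂ) :
    ((X * Y)ᴴ * (X * Y)).trace.re ≤ (Xᴴ * X).trace.re * (Yᴴ * Y).trace.re := by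
  simp only [trace_conjTranspose_mul_self_re]
  rw [Finset.sum_comm (f := fun j i => ‖X i j‖ ^ 2), mul_comm, Finset.sum_mul_sum]
  refine Finset.sum_le_sum fun j _ => Finset.sum_le_sum fun i _ => ?_
  have h1 : ‖(X * Y) i j‖ ≤ ∑ r, ‖Y r j‖ * ‖X i r‖ := by
    rw [mul_apply]
    refine (norm_sum_le _ _).trans (le_of_eq (Finset.sum_congr rfl fun r _ => ?_))
    rw [norm_mul, mul_comm]
  exact (pow_le_pow_left₀ (norm_nonneg _) h1 2).trans (Finset.sum_mul_sq_le_sq_mul_sq _ _ _)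

/-- Polar-type factorisation of a matrix with linearly independent columns. -/
lemma exists_isometry_mul (A : Matrix (Fin m) (Fin n) ℂ) (hA : gramDet A ≠ 0) :
    ∃ (U : Matrix (Fin m) (Fin n) ℂ) (R : Matrix (Fin n) (Fin n) ℂ),
      Uᴴ * U = 1 ∧ A = U * R ∧ Rᴴ * R = Aᴴ * A := by
  have hdet := det_ne_zero_of_gramDet_ne_zero hA
  obtain ⟨R, hR⟩ : ∃ R : Matrix (Fin n) (Fin n) ℂ, Aᴴ * A = Rᴴ * R := by
    open scoped MatrixOrder in
    exact CStarAlgebra.nonneg_iff_eq_star_mul_self.mp (posSemidef_conjTranspose_mul_self A).nonneg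
  have hRdet : IsUnit R.det := by
    rw [hR, det_mul] at hdet
    exact (right_ne_zero_of_mul hdet).isUnit
  refine ⟨A * R⁻¹, R, ?_, ?_, hR.symm⟩
  · rw [conjTranspose_mul, Matrix.mul_assoc, ← Matrix.mul_assoc Aᴴ, hR, conjTranspose_nonsing_inv,
      Matrix.mul_assoc, mul_nonsing_inv _ hRdet, Matrix.mul_one, nonsing_inv_mul]
    rwa [det_conjTranspose, isUnit_star]
  · rw [Matrix.mul_assoc, nonsing_inv_mul _ hRdet, Matrix.mul_one]

lemma gramDet_mul (G : Matrix (Fin m) (Fin n) ℂ) (R : Matrix (Fin n) (Fin n) ℂ) :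
    gramDet (G * R) = gramDet G * gramDet R := by
  have : ((gramDet (G * R) : ℝ) : ℂ) = ((gramDet G * gramDet R : ℝ) : ℂ) := by
    rw [Complex.ofReal_mul, ofReal_gramDet, ofReal_gramDet, ofReal_gramDet, conjTranspose_mul,
      Matrix.mul_assoc, ← Matrix.mul_assoc Gᴴ, det_mul, det_mul, det_mul]
    ring
  exact_mod_cast this

/-- The inverse trace is a squared Frobenius norm of a square root of the inverse, so
submultiplicativity applies. Singular matrices need no exception, as `Matrix.mul_inv_rev` holds for
the totalised inverse. -/
lemma gramInvTrace_mul_le (G : Matrix (Fin m) (Fin n) ℂ) (R : Matrix (Fin n) (Fin n) ℂ) :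
    gramInvTrace (G * R) ≤ gramInvTrace G * gramInvTrace R := by
  obtain ⟨M, hM⟩ : ∃ M : Matrix (Fin n) (Fin n) ℂ, (Gᴴ * G)⁻¹ = Mᴴ * M := by
    open scoped MatrixOrder in
    exact CStarAlgebra.nonneg_iff_eq_star_mul_self.mp
      (posSemidef_conjTranspose_mul_self G).inv.nonneg
  have h := sum_normSq_mul_le M (R⁻¹)ᴴ
  have h1 : gramInvTrace (G * R) = ((M * (R⁻¹)ᴴ)ᴴ * (M * (R⁻¹)ᴴ)).trace.re := by
    unfold gramInvTrace
    rw [conjTranspose_mul, Matrix.mul_assoc, ← Matrix.mul_assoc Gᴴ, Matrix.mul_inv_rev, Matrix.mul_inv_rev, hM,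
      conjTranspose_mul, conjTranspose_conjTranspose, conjTranspose_nonsing_inv]
    simp only [Matrix.mul_assoc]
  have h2 : gramInvTrace R = ((R⁻¹)ᴴᴴ * (R⁻¹)ᴴ).trace.re := by
    unfold gramInvTrace
    rw [Matrix.mul_inv_rev, conjTranspose_conjTranspose, conjTranspose_nonsing_inv]
  rw [h1, h2]
  unfold gramInvTrace
  rwa [hM]

/-- Rayleigh quotient of `1 + M` at a unit eigenvector. -/
lemma one_le_eigenvalues_one_add {M : Matrix (Fin n) (Fin n) ℂ} (hM : M.PosSemidef)
    (h : (1 + M).IsHermitian) (i : Fin n) : 1 ≤ h.eigenvalues i := by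
  rw [h.eigenvalues_eq, add_mulVec, one_mulVec, dotProduct_add, map_add]
  have h1 : (star (h.eigenvectorBasis i).ofLp ⬝ᵥ (h.eigenvectorBasis i).ofLp) = 1 := by
    have := orthonormal_iff_ite.mp h.eigenvectorBasis.orthonormal i i
    rw [if_pos rfl, EuclideanSpace.inner_eq_star_dotProduct] at this
    rw [← this, dotProduct_comm]
  have h2 := (RCLike.le_iff_re_im.mp
    (hM.dotProduct_mulVec_nonneg (h.eigenvectorBasis i).ofLp)).1
  rw [h1]
  simp only [map_zero] at h2
  simp only [RCLike.one_re]
  linarith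

lemma log_one_add_le_two_mul_sqrt {t : ℝ} (ht : 0 ≤ t) : Real.log (1 + t) ≤ 2 * Real.sqrt t := by
  have h1 : 1 + t ≤ (1 + Real.sqrt t) ^ 2 := by
    nlinarith [Real.sq_sqrt ht, Real.sqrt_nonneg t]
  have h2 : 0 < 1 + Real.sqrt t := by positivity
  calc Real.log (1 + t) ≤ Real.log ((1 + Real.sqrt t) ^ 2) :=
        Real.log_le_log (by linarith) h1
    _ = 2 * Real.log (1 + Real.sqrt t) := by simp [Real.log_pow]
    _ ≤ 2 * Real.sqrt t := by
        have := Real.log_le_sub_one_of_pos h2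
        linarith

/-- Each eigenvalue of `M` is at most the trace. The square-root bound on `log (1 + t)` leaves only
a half-order moment to control. -/
lemma log_det_one_add_bounds {M : Matrix (Fin n) (Fin n) ℂ} (hM : M.PosSemidef) :
    0 < (1 + M).det.re ∧ (((1 + M).det.re : ℝ) : ℂ) = (1 + M).det ∧
    0 ≤ Real.log (1 + M).det.re ∧
      Real.log (1 + M).det.re ≤ 2 * n * Real.sqrt M.trace.re := by
  have h : (1 + M).IsHermitian := isHermitian_one.add hM.isHermitian
  have h1 := one_le_eigenvalues_one_add hM h
  have hdet : (1 + M).det = ((∏ i, h.eigenvalues i : ℝ) : ℂ) := by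
    rw [h.det_eq_prod_eigenvalues]
    simp
  have htr : ∑ i, (h.eigenvalues i - 1) = M.trace.re := by
    have := congrArg Complex.re h.trace_eq_sum_eigenvalues
    rw [trace_add, trace_one, Complex.add_re, Complex.re_sum] at this
    simp at this
    simp
    linarith
  have hpos : ∀ i, 0 < h.eigenvalues i := fun i => by linarith [h1 i]
  rw [hdet, Complex.ofReal_re]
  have ht : 0 ≤ M.trace.re := (Complex.le_def.mp hM.trace_nonneg).1
  refine ⟨Finset.prod_pos fun i _ => hpos i, rfl, ?_, ?_⟩
  · rw [Real.log_prod fun i _ => (hpos i).ne']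
    exact Finset.sum_nonneg fun i _ => Real.log_nonneg (h1 i)
  · rw [Real.log_prod fun i _ => (hpos i).ne']
    have : ∀ i ∈ Finset.univ, Real.log (h.eigenvalues i) ≤ 2 * Real.sqrt M.trace.re := by
      intro i hi
      refine le_trans (Real.log_le_log (hpos i) ?_) (log_one_add_le_two_mul_sqrt ht)
      have := Finset.single_le_sum (f := fun i => h.eigenvalues i - 1)
        (fun i _ => by linarith [h1 i]) hi
      linarith
    refine (Finset.sum_le_sum this).trans (le_of_eq ?_)
    simp
    ring

/-- High-power expansion of the log-determinant with an explicit remainder. -/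
lemma log_det_one_add_smul_bounds (A : Matrix (Fin m) (Fin n) ℂ) (hA : gramDet A ≠ 0) {q : ℝ}
    (hq : 0 < q) :
    0 ≤ Real.log ((1 + (q : ℂ) • (Aᴴ * A)).det).re - (n * Real.log q + Real.log (gramDet A)) ∧
    Real.log ((1 + (q : ℂ) • (Aᴴ * A)).det).re - (n * Real.log q + Real.log (gramDet A)) ≤
      2 * n * Real.sqrt (gramInvTrace A / q) := by
  have hdet := (det_ne_zero_of_gramDet_ne_zero hA).isUnit
  have hqc : (q : ℂ) ≠ 0 := by exact_mod_cast hq.ne'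
  set M : Matrix (Fin n) (Fin n) ℂ := ((q⁻¹ : ℝ) : ℂ) • (Aᴴ * A)⁻¹ with hMdef
  have hM : M.PosSemidef := (posSemidef_conjTranspose_mul_self A).inv.smul
    (by exact_mod_cast (inv_pos.mpr hq).le)
  obtain ⟨h1, h2, h3, h4⟩ := log_det_one_add_bounds hM
  -- Pulling out `q Aᴴ A` leaves `1 + M`, with `M` its inverse; the log-determinant of `1 + M` is
  -- exactly the remainder.
  have hfac : 1 + (q : ℂ) • (Aᴴ * A) = ((q : ℂ) • (Aᴴ * A)) * (1 + M) := by
    rw [Matrix.mul_add, Matrix.mul_one, hMdef, Matrix.smul_mul, Matrix.mul_smul,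
      mul_nonsing_inv _ hdet, smul_smul, Complex.ofReal_inv, mul_inv_cancel₀ hqc, one_smul,
      add_comm]
  have hre : ((1 + (q : ℂ) • (Aᴴ * A)).det).re = q ^ n * gramDet A * (1 + M).det.re := by
    rw [hfac, det_mul, det_smul, Fintype.card_fin, ← ofReal_gramDet, ← h2, Complex.ofReal_re]
    rw [← Complex.ofReal_pow, ← Complex.ofReal_mul, ← Complex.ofReal_mul, Complex.ofReal_re]
  have htr : M.trace.re = gramInvTrace A / q := by
    rw [hMdef, trace_smul, smul_eq_mul, Complex.re_ofReal_mul, gramInvTrace]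
    ring
  have hlog : Real.log ((1 + (q : ℂ) • (Aᴴ * A)).det).re =
      n * Real.log q + Real.log (gramDet A) + Real.log (1 + M).det.re := by
    rw [hre, Real.log_mul (by positivity) h1.ne', Real.log_mul (by positivity) hA, Real.log_pow]
  rw [hlog, ← htr]
  constructor <;> linarith

end LinearAlgebra

end GramMatrix

/-! ### Measurability of the Gram functionals -/

section Measurability

variable {X : Type*} [TopologicalSpace X] {m n : ℕ} {f : X → Matrix (Fin m) (Fin n) ℂ}

lemma continuous_gramDet (hf : Continuous f) : Continuous fun x => gramDet (f x) :=
  Complex.continuous_re.comp (hf.matrix_conjTranspose.matrix_mul hf).matrix_det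

lemma measurable_gramInvTrace [MeasurableSpace X] [OpensMeasurableSpace X] (hf : Continuous f) :
    Measurable fun x => gramInvTrace (f x) := by
  have hg : Continuous fun x => (f x)ᴴ * f x := hf.matrix_conjTranspose.matrix_mul hf
  unfold gramInvTrace
  simp_rw [inv_def, trace_smul, Ring.inverse_eq_inv', smul_eq_mul]
  exact Complex.measurable_re.comp
    (hg.matrix_det.measurable.inv.mul hg.matrix_adjugate.matrix_trace.measurable)

end Measurability

/-! ### A single Rayleigh factor -/

section OneFactor

/-- Removing the `j`-th of several independent Gaussian columns. -/
lemma measurePreserving_succAbove (n m : ℕ) (j : Fin (n + 1)) :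
    MeasurePreserving (fun (c : Fin (n + 1) → Fin m → ℂ) i => c (j.succAbove i))
      (rayleighLaw (n + 1) m) (rayleighLaw n m) :=
  measurePreserving_snd.comp (measurePreserving_piFinSuccAbove (fun _ => gaussVec m) j)

/-- Given the other columns, the ratio is `‖V a‖²` with `V a` standard Gaussian in dimension `m -
n`, a law not depending on them. The nondegeneracy hypothesis concerns one column fewer, which lets
this lemma drive the induction proving it. -/
lemma map_gramDet_ratio_aux {n m : ℕ} (hnm : n + 1 ≤ m) (j : Fin (n + 1))
    (hae : ∀ᵐ c ∂(rayleighLaw n m), gramDet (Matrix.of c)ᵀ ≠ 0) :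
    (rayleighLaw (n + 1) m).map (fun c => gramDet (Matrix.of c)ᵀ /
      gramDet ((Matrix.of c)ᵀ.submatrix id j.succAbove)) = gammaMeasure (m - n : ℕ) 1 := by
  set e := MeasurableEquiv.piFinSuccAbove (fun _ : Fin (n + 1) => Fin m → ℂ) j with he
  have hmp : MeasurePreserving e (rayleighLaw (n + 1) m) ((gaussVec m).prod (rayleighLaw n m)) :=
    measurePreserving_piFinSuccAbove (fun _ => gaussVec m) j
  set r : (Fin (n + 1) → Fin m → ℂ) → ℝ := fun c => gramDet (Matrix.of c)ᵀ /
      gramDet ((Matrix.of c)ᵀ.submatrix id j.succAbove) with hr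
  have hc : Continuous fun c : Fin (n + 1) → Fin m → ℂ => (Matrix.of c)ᵀ :=
    Continuous.matrix_transpose continuous_id
  have hrm : Measurable r := (continuous_gramDet hc).measurable.div
    (continuous_gramDet (hc.matrix_submatrix id j.succAbove)).measurable
  have hre : r = (r ∘ e.symm) ∘ e := by
    ext c
    simp
  rw [hre, ← Measure.map_map (hrm.comp e.symm.measurable) e.measurable, hmp.map_eq]
  refine map_prod_eq_of_ae_map_eq (hrm.comp e.symm.measurable) ?_
  filter_upwards [hae] with b hb
  obtain ⟨V, hV1, hV2⟩ := exists_orthogonal_coisometry (Matrix.of b)ᵀ hb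
  have hcol : ∀ a : Fin m → ℂ, e.symm (a, b) = j.insertNth a b := fun a => rfl
  have hsub : ∀ a : Fin m → ℂ,
      (Matrix.of (e.symm (a, b)))ᵀ.submatrix id j.succAbove = (Matrix.of b)ᵀ := by
    intro a
    ext i k
    simp [hcol]
  have hval : ∀ a : Fin m → ℂ, (r ∘ e.symm) (a, b) = ∑ i, ‖(V *ᵥ a) i‖ ^ 2 := by
    intro a
    have h := gramDet_eq_mul_sum_normSq (Matrix.of (e.symm (a, b)))ᵀ j V
      (by rw [hsub]; exact hV2) (by rw [hsub]; exact hb)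
    have ha : (fun k => (Matrix.of (e.symm (a, b)))ᵀ k j) = a := by
      ext k
      simp [hcol]
    rw [ha, hsub] at h
    simp only [Function.comp_apply, hr]
    rw [h, hsub, mul_div_cancel_left₀ _ hb]
  simp_rw [hval]
  have hcV : Continuous (fun x : Fin m → ℂ => V *ᵥ x) := by fun_prop
  have hcN : Continuous (fun x : Fin (m - n) → ℂ => ∑ i, ‖x i‖ ^ 2) := by fun_prop
  have := Measure.map_map (μ := gaussVec m) hcN.measurable hcV.measurable
  rw [map_mulVec_gaussVec V hV1, map_normSq_gaussVec _ (by omega)] at this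
  exact this.symm

lemma ae_gramDet_transpose_ne_zero {n m : ℕ} (hnm : n ≤ m) :
    ∀ᵐ c ∂(rayleighLaw n m), gramDet (Matrix.of c)ᵀ ≠ 0 := by
  induction n with
  | zero =>
    refine ae_of_all _ fun c => ?_
    simp [gramDet]
  | succ n ih =>
    have h := map_gramDet_ratio_aux hnm 0 (ih (by omega))
    have hpos := ae_gammaMeasure_pos ((m - n : ℕ) : ℝ)
    rw [← h] at hpos
    -- A nonzero push-forward certifies the a.e. measurability that `ae_of_ae_map` needs.
    have hne : (rayleighLaw (n + 1) m).map (fun c => gramDet (Matrix.of c)ᵀ /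
      gramDet ((Matrix.of c)ᵀ.submatrix id (Fin.succAbove 0))) ≠ 0 := by
      rw [h]
      have := isProbabilityMeasure_gammaMeasure (a := ((m - n : ℕ) : ℝ)) (r := 1)
        (by exact_mod_cast (by omega : 0 < m - n)) one_pos
      exact IsProbabilityMeasure.ne_zero _
    have := ae_of_ae_map (AEMeasurable.of_map_ne_zero hne) hpos
    filter_upwards [this] with c hc h0
    simp [h0] at hc

/-- The ratio of the Gram determinants with and without the `j`-th column is
`Gamma (m - n, 1)`-distributed. -/
lemma map_gramDet_ratio {n m : ℕ} (hnm : n + 1 ≤ m) (j : Fin (n + 1)) :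
    (rayleighLaw (n + 1) m).map (fun c => gramDet (Matrix.of c)ᵀ /
      gramDet ((Matrix.of c)ᵀ.submatrix id j.succAbove)) = gammaMeasure (m - n : ℕ) 1 :=
  map_gramDet_ratio_aux hnm j (ae_gramDet_transpose_ne_zero (by omega))

lemma measurable_gramDet_ratio (n m : ℕ) (j : Fin (n + 1)) :
    Measurable (fun c : Fin (n + 1) → Fin m → ℂ => gramDet (Matrix.of c)ᵀ /
      gramDet ((Matrix.of c)ᵀ.submatrix id j.succAbove)) := by
  have hc : Continuous fun c : Fin (n + 1) → Fin m → ℂ => (Matrix.of c)ᵀ :=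
    Continuous.matrix_transpose continuous_id
  exact (continuous_gramDet hc).measurable.div
    (continuous_gramDet (hc.matrix_submatrix id j.succAbove)).measurable

/-- The determinant telescopes into the successive column ratios, whose logarithms have digamma
means. -/
lemma log_gramDet_transpose {n m : ℕ} (hnm : n ≤ m) :
    Integrable (fun c => Real.log (gramDet (Matrix.of c)ᵀ)) (rayleighLaw n m) ∧
      ∫ c, Real.log (gramDet (Matrix.of c)ᵀ) ∂(rayleighLaw n m) =
        ∑ i ∈ Finset.range n, digamma (m - i : ℕ) := by
  induction n with
  | zero => simp [gramDet]
  | succ n ih =>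
    obtain ⟨ih1, ih2⟩ := ih (by omega)
    have hmp := measurePreserving_succAbove n m 0
    set r : (Fin (n + 1) → Fin m → ℂ) → ℝ := fun c => gramDet (Matrix.of c)ᵀ /
      gramDet ((Matrix.of c)ᵀ.submatrix id (Fin.succAbove 0)) with hr
    have hrm : Measurable r := measurable_gramDet_ratio n m 0
    have hmap : (rayleighLaw (n + 1) m).map r = gammaMeasure (m - n : ℕ) 1 :=
      map_gramDet_ratio hnm 0
    have hd : 1 ≤ m - n := by omega
    have hlog_meas : ∀ μ : Measure ℝ, AEStronglyMeasurable Real.log μ :=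
      fun μ => Real.measurable_log.aestronglyMeasurable
    have hI1 : Integrable (fun c => Real.log (r c)) (rayleighLaw (n + 1) m) := by
      have := integrable_log_gammaMeasure _ hd
      rw [← hmap] at this
      exact this.comp_measurable hrm
    have hE1 : ∫ c, Real.log (r c) ∂(rayleighLaw (n + 1) m) = digamma (m - n : ℕ) := by
      rw [← integral_log_gammaMeasure _ hd, ← hmap,
        integral_map hrm.aemeasurable (hlog_meas _)]
    have hI2 : Integrable (fun c : Fin (n + 1) → Fin m → ℂ => Real.log (gramDet
        (Matrix.of fun i => c (Fin.succAbove 0 i))ᵀ)) (rayleighLaw (n + 1) m) :=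
      hmp.integrable_comp_of_integrable ih1
    have hE2 : ∫ c : Fin (n + 1) → Fin m → ℂ, Real.log (gramDet
        (Matrix.of fun i => c (Fin.succAbove 0 i))ᵀ) ∂(rayleighLaw (n + 1) m) =
        ∑ i ∈ Finset.range n, digamma (m - i : ℕ) := by
      rw [← ih2, ← hmp.map_eq, integral_map hmp.measurable.aemeasurable]
      rw [hmp.map_eq]
      exact ih1.aestronglyMeasurable
    have hae : (fun c => Real.log (gramDet (Matrix.of c)ᵀ)) =ᵐ[rayleighLaw (n + 1) m]
        fun c => Real.log (r c) + Real.log (gramDet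
          (Matrix.of fun i => c (Fin.succAbove 0 i))ᵀ) := by
      have h1 := ae_gramDet_transpose_ne_zero hnm
      have h2 := hmp.quasiMeasurePreserving.ae
        (ae_gramDet_transpose_ne_zero (n := n) (m := m) (by omega))
      filter_upwards [h1, h2] with c hc1 hc2
      have hsub : (Matrix.of c)ᵀ.submatrix id (Fin.succAbove 0) =
        (Matrix.of fun i => c (Fin.succAbove 0 i))ᵀ := rfl
      simp only [hr, hsub]
      rw [Real.log_div hc1 hc2]
      ring
    refine ⟨(hI1.add hI2).congr hae.symm, ?_⟩
    rw [integral_congr_ae hae, integral_add hI1 hI2, hE1, hE2, Finset.sum_range_succ, add_comm]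

lemma sqrt_sum_le {ι : Type*} (s : Finset ι) (f : ι → ℝ) (hf : ∀ i, 0 ≤ f i) :
    Real.sqrt (∑ i ∈ s, f i) ≤ ∑ i ∈ s, Real.sqrt (f i) := by
  classical
  induction s using Finset.induction_on with
  | empty => simp
  | insert i s hi ih =>
    rw [Finset.sum_insert hi, Finset.sum_insert hi]
    have hs : 0 ≤ ∑ j ∈ s, f j := Finset.sum_nonneg fun j _ => hf j
    refine le_trans ?_ (add_le_add_right ih _)
    rw [Real.sqrt_le_left (by positivity)]
    nlinarith [Real.sq_sqrt (hf i), Real.sq_sqrt hs,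
      mul_nonneg (Real.sqrt_nonneg (f i)) (Real.sqrt_nonneg (∑ j ∈ s, f j))]

lemma lintegral_sqrt_gramInvTrace_transpose_le {n m : ℕ} (hnm : n + 1 ≤ m) :
    ∫⁻ c, ENNReal.ofReal (Real.sqrt (gramInvTrace (Matrix.of c)ᵀ)) ∂(rayleighLaw (n + 1) m) ≤
      ENNReal.ofReal (2 * (n + 1) * Real.sqrt (n + 1) / Real.sqrt m) := by
  have hd : 1 ≤ m - n := by omega
  have h1 : ∀ c : Fin (n + 1) → Fin m → ℂ,
      ENNReal.ofReal (Real.sqrt (gramInvTrace (Matrix.of c)ᵀ)) ≤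
      ∑ j : Fin (n + 1), ENNReal.ofReal (Real.sqrt (gramDet (Matrix.of c)ᵀ /
        gramDet ((Matrix.of c)ᵀ.submatrix id j.succAbove))⁻¹) := by
    intro c
    rw [← ENNReal.ofReal_sum_of_nonneg fun j _ => Real.sqrt_nonneg _, gramInvTrace_eq_sum]
    exact ENNReal.ofReal_le_ofReal (sqrt_sum_le _ _ fun j =>
      inv_nonneg.mpr (div_nonneg (gramDet_nonneg _) (gramDet_nonneg _)))
  have h2 : ∀ j : Fin (n + 1), ∫⁻ c, ENNReal.ofReal (Real.sqrt (gramDet (Matrix.of c)ᵀ /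
        gramDet ((Matrix.of c)ᵀ.submatrix id j.succAbove))⁻¹) ∂(rayleighLaw (n + 1) m) ≤
      ENNReal.ofReal (2 / Real.sqrt (m - n : ℕ)) := by
    intro j
    refine le_trans (le_of_eq ?_) (lintegral_inv_sqrt_gammaMeasure_le _ hd)
    rw [← map_gramDet_ratio hnm j, lintegral_map (by fun_prop) (measurable_gramDet_ratio n m j)]
  have h3 : 2 / Real.sqrt (m - n : ℕ) ≤ 2 * Real.sqrt (n + 1) / Real.sqrt m := by
    -- The bound amounts to `m ≤ (n + 1) (m - n)`: with `m = n + k + 1` the excess on the right is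
    -- `n k`. It turns decay in `m - n` into decay in `m`.
    have hdp : (0 : ℝ) < (m - n : ℕ) := by exact_mod_cast hd
    have hmp : (0 : ℝ) < m := by exact_mod_cast (by omega : 0 < m)
    rw [div_le_div_iff₀ (Real.sqrt_pos.mpr hdp) (Real.sqrt_pos.mpr hmp), mul_assoc,
      ← Real.sqrt_mul (by positivity)]
    refine mul_le_mul_of_nonneg_left (Real.sqrt_le_sqrt ?_) two_pos.le
    obtain ⟨k, rfl⟩ : ∃ k, m = n + (k + 1) := ⟨m - n - 1, by omega⟩
    rw [Nat.add_sub_cancel_left]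
    push_cast
    nlinarith [mul_nonneg (Nat.cast_nonneg (α := ℝ) n) (Nat.cast_nonneg (α := ℝ) k)]
  calc _ ≤ ∫⁻ c, ∑ j : Fin (n + 1), ENNReal.ofReal (Real.sqrt (gramDet (Matrix.of c)ᵀ /
        gramDet ((Matrix.of c)ᵀ.submatrix id j.succAbove))⁻¹) ∂(rayleighLaw (n + 1) m) :=
        lintegral_mono h1
    _ = ∑ j : Fin (n + 1), ∫⁻ c, ENNReal.ofReal (Real.sqrt (gramDet (Matrix.of c)ᵀ /
        gramDet ((Matrix.of c)ᵀ.submatrix id j.succAbove))⁻¹) ∂(rayleighLaw (n + 1) m) := by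
        rw [lintegral_finsetSum]
        intro j _
        exact ((measurable_gramDet_ratio n m j).inv.sqrt).ennreal_ofReal
    _ ≤ ∑ j : Fin (n + 1), ENNReal.ofReal (2 * Real.sqrt (n + 1) / Real.sqrt m) :=
        Finset.sum_le_sum fun j _ => (h2 j).trans (ENNReal.ofReal_le_ofReal h3)
    _ = _ := by
        rw [← ENNReal.ofReal_sum_of_nonneg (fun _ _ => by positivity)]
        congr 1
        simp
        ring

variable {n m : ℕ}

lemma measurePreserving_swap (m n : ℕ) :
    MeasurePreserving (fun (Q : Fin m → Fin n → ℂ) j i => Q i j) (rayleighLaw m n)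
      (rayleighLaw n m) :=
  ⟨by fun_prop, map_swap_rayleighLaw m n⟩

lemma ae_gramDet_ne_zero (hnm : n ≤ m) :
    ∀ᵐ Q ∂(rayleighLaw m n), gramDet (Matrix.of Q) ≠ 0 :=
  (measurePreserving_swap m n).quasiMeasurePreserving.ae (ae_gramDet_transpose_ne_zero hnm)

lemma integrable_log_gramDet (hnm : n ≤ m) :
    Integrable (fun Q => Real.log (gramDet (Matrix.of Q))) (rayleighLaw m n) :=
  (measurePreserving_swap m n).integrable_comp_of_integrable (log_gramDet_transpose hnm).1

/-- The mean of the log-determinant of a complex Wishart matrix. -/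
lemma integral_log_gramDet (hnm : n ≤ m) :
    ∫ Q, Real.log (gramDet (Matrix.of Q)) ∂(rayleighLaw m n) =
      ∑ i ∈ Finset.range n, digamma (m - i : ℕ) := by
  rw [← (log_gramDet_transpose hnm).2, ← map_swap_rayleighLaw m n,
    integral_map (measurePreserving_swap m n).measurable.aemeasurable]
  · rfl
  · rw [map_swap_rayleighLaw m n]
    exact (log_gramDet_transpose hnm).1.aestronglyMeasurable

lemma lintegral_sqrt_gramInvTrace_le (hn : 1 ≤ n) (hnm : n ≤ m) :
    ∫⁻ Q, ENNReal.ofReal (Real.sqrt (gramInvTrace (Matrix.of Q))) ∂(rayleighLaw m n) ≤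
      ENNReal.ofReal (2 * n * Real.sqrt n / Real.sqrt m) := by
  obtain ⟨k, rfl⟩ : ∃ k, n = k + 1 := ⟨n - 1, by omega⟩
  have h := lintegral_sqrt_gramInvTrace_transpose_le hnm
  have hc : Continuous fun c : Fin (k + 1) → Fin m → ℂ => (Matrix.of c)ᵀ :=
    Continuous.matrix_transpose continuous_id
  rw [← map_swap_rayleighLaw m (k + 1), lintegral_map
    (measurable_gramInvTrace hc).sqrt.ennreal_ofReal (by fun_prop)] at h
  push_cast
  exact h

end OneFactor

/-! ### The product channel, one factor at a time -/

section Product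

/-- Right multiplication by an isometry maps a Rayleigh channel to a Rayleigh channel. -/
lemma map_mul_isometry_rayleighLaw (N : ℕ) {m n : ℕ} (U : Matrix (Fin m) (Fin n) ℂ)
    (hU : Uᴴ * U = 1) :
    (rayleighLaw N m).map (fun Q i => Uᵀ *ᵥ Q i) = rayleighLaw N n := by
  -- Row `i` of `Q U` is `Uᵀ` applied to row `i` of `Q`, without conjugation, so it is `Uᵀ` that
  -- must have orthonormal rows.
  have h1 : Uᵀ * Uᵀᴴ = 1 := by
    have := congrArg transpose hU
    rwa [transpose_mul, transpose_one] at this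
  have h2 : Measurable fun x : Fin m → ℂ => Uᵀ *ᵥ x :=
    (by fun_prop : Continuous fun x : Fin m → ℂ => Uᵀ *ᵥ x).measurable
  have : ∀ i : Fin N, SigmaFinite ((gaussVec m).map (fun x => Uᵀ *ᵥ x)) := by
    intro i
    rw [map_mulVec_gaussVec _ h1]
    infer_instance
  rw [rayleighLaw_eq, Measure.pi_map_pi (fun _ => h2.aemeasurable), map_mulVec_gaussVec _ h1]
  rfl

lemma of_transpose_mulVec {N m n : ℕ} (U : Matrix (Fin m) (Fin n) ℂ) (Q : Fin N → Fin m → ℂ) :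
    Matrix.of (fun i => Uᵀ *ᵥ Q i) = Matrix.of Q * U := by
  ext i j
  simp [mul_apply, mulVec, dotProduct, mul_comm]

section FixedInner

variable {N m n : ℕ} {A : Matrix (Fin m) (Fin n) ℂ}

/-- With `A = U R`, the difference is almost surely the log-determinant of `Q U`, a Rayleigh channel
whose law forgets `A`. -/
lemma map_log_gramDet_mul_sub (hnN : n ≤ N) (hA : gramDet A ≠ 0) :
    (rayleighLaw N m).map
      (fun Q => Real.log (gramDet (Matrix.of Q * A)) - Real.log (gramDet A)) =
      (rayleighLaw N n).map (fun Q => Real.log (gramDet (Matrix.of Q))) := by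
  obtain ⟨U, R, hU, hAUR, hR⟩ := exists_isometry_mul A hA
  have hgR : gramDet R = gramDet A := by rw [gramDet, hR, gramDet]
  have hmp : MeasurePreserving (fun (Q : Fin N → Fin m → ℂ) i => Uᵀ *ᵥ Q i) (rayleighLaw N m)
      (rayleighLaw N n) :=
    ⟨(by fun_prop : Continuous _).measurable, map_mul_isometry_rayleighLaw N U hU⟩
  have hae : (fun Q => Real.log (gramDet (Matrix.of Q * A)) - Real.log (gramDet A))
      =ᵐ[rayleighLaw N m] (fun Q => Real.log (gramDet (Matrix.of Q))) ∘
        (fun (Q : Fin N → Fin m → ℂ) i => Uᵀ *ᵥ Q i) := by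
    filter_upwards [hmp.quasiMeasurePreserving.ae (ae_gramDet_ne_zero hnN)] with Q hQ
    have : gramDet (Matrix.of Q * A) =
        gramDet (Matrix.of (fun i => Uᵀ *ᵥ Q i)) * gramDet A := by
      rw [hAUR, ← Matrix.mul_assoc, ← of_transpose_mulVec, gramDet_mul, hgR, ← hAUR]
    rw [this, Real.log_mul hQ hA]
    simp
  rw [Measure.map_congr hae, ← Measure.map_map _ hmp.measurable, hmp.map_eq]
  exact (continuous_gramDet (by fun_prop)).measurable.log

lemma ae_gramDet_mul_ne_zero (hnN : n ≤ N) (hA : gramDet A ≠ 0) :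
    ∀ᵐ Q ∂(rayleighLaw N m), gramDet (Matrix.of Q * A) ≠ 0 := by
  obtain ⟨U, R, hU, hAUR, hR⟩ := exists_isometry_mul A hA
  have hgR : gramDet R = gramDet A := by rw [gramDet, hR, gramDet]
  have hmp : MeasurePreserving (fun (Q : Fin N → Fin m → ℂ) i => Uᵀ *ᵥ Q i) (rayleighLaw N m)
      (rayleighLaw N n) :=
    ⟨(by fun_prop : Continuous _).measurable, map_mul_isometry_rayleighLaw N U hU⟩
  filter_upwards [hmp.quasiMeasurePreserving.ae (ae_gramDet_ne_zero hnN)] with Q hQ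
  rw [hAUR, ← Matrix.mul_assoc, ← of_transpose_mulVec, gramDet_mul, hgR]
  exact mul_ne_zero hQ hA

/-- Same reduction to `Q U`, with submultiplicativity in place of the exact determinant identity. -/
lemma lintegral_sqrt_gramInvTrace_mul_le (hn : 1 ≤ n) (hnN : n ≤ N) (hA : gramDet A ≠ 0) :
    ∫⁻ Q, ENNReal.ofReal (Real.sqrt (gramInvTrace (Matrix.of Q * A))) ∂(rayleighLaw N m) ≤
      ENNReal.ofReal (2 * n * Real.sqrt n / Real.sqrt N) *
        ENNReal.ofReal (Real.sqrt (gramInvTrace A)) := by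
  obtain ⟨U, R, hU, hAUR, hR⟩ := exists_isometry_mul A hA
  have hgR : gramInvTrace R = gramInvTrace A := by rw [gramInvTrace, hR, gramInvTrace]
  have hmp : MeasurePreserving (fun (Q : Fin N → Fin m → ℂ) i => Uᵀ *ᵥ Q i) (rayleighLaw N m)
      (rayleighLaw N n) :=
    ⟨(by fun_prop : Continuous _).measurable, map_mul_isometry_rayleighLaw N U hU⟩
  have hmeas : Measurable fun Q : Fin N → Fin n → ℂ =>
      ENNReal.ofReal (Real.sqrt (gramInvTrace (Matrix.of Q))) :=
    (measurable_gramInvTrace (by fun_prop)).sqrt.ennreal_ofReal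
  calc _ ≤ ∫⁻ Q, ENNReal.ofReal (Real.sqrt (gramInvTrace (Matrix.of fun i => Uᵀ *ᵥ Q i))) *
        ENNReal.ofReal (Real.sqrt (gramInvTrace A)) ∂(rayleighLaw N m) := by
        refine lintegral_mono fun Q => ?_
        rw [← ENNReal.ofReal_mul (Real.sqrt_nonneg _), ← Real.sqrt_mul (gramInvTrace_nonneg _)]
        refine ENNReal.ofReal_le_ofReal (Real.sqrt_le_sqrt ?_)
        rw [of_transpose_mulVec, ← hgR]
        conv_lhs => rw [hAUR, ← Matrix.mul_assoc]
        exact gramInvTrace_mul_le _ _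
    _ = (∫⁻ Q, ENNReal.ofReal (Real.sqrt (gramInvTrace (Matrix.of Q))) ∂(rayleighLaw N n)) *
        ENNReal.ofReal (Real.sqrt (gramInvTrace A)) := by
        rw [← hmp.map_eq, lintegral_map hmeas hmp.measurable, lintegral_mul_const]
        exact hmeas.comp hmp.measurable
    _ ≤ _ := by
        gcongr
        exact lintegral_sqrt_gramInvTrace_le hn hnN

end FixedInner

lemma continuous_channel (K : ℕ) (N : ℕ → ℕ) : Continuous (channel K N) := by
  induction K with
  | zero => exact continuous_const
  | succ K ih =>
    have h : Continuous fun Q : Factors (K + 1) N =>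
        (Matrix.of (Q (Fin.last K)) : Matrix (Fin (N (K + 1))) (Fin (N K)) ℂ) :=
      continuous_apply (Fin.last K)
    exact h.matrix_mul (ih.comp (by fun_prop))

/-- The last factor is independent of the others. -/
lemma measurePreserving_split_last (K : ℕ) (N : ℕ → ℕ) :
    MeasurePreserving (fun Q : Factors (K + 1) N => ((Q (Fin.last K), fun k => Q k.castSucc) :
        (Fin (N (K + 1)) → Fin (N K) → ℂ) × Factors K N))
      (factorsLaw (K + 1) N) ((rayleighLaw (N (K + 1)) (N K)).prod (factorsLaw K N)) := by
  let g : (Fin (N (K + 1)) → Fin (N K) → ℂ) × Factors K N → Factors (K + 1) N :=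
    fun p => Fin.snoc (α := fun k : Fin (K + 1) => Fin (N (k + 1)) → Fin (N k) → ℂ) p.2 p.1
  have hg : Measurable g := by
    refine measurable_pi_lambda _ fun k => ?_
    refine Fin.lastCases ?_ (fun i => ?_) k
    · simp only [g, Fin.snoc_last]
      exact measurable_fst
    · simp only [g, Fin.snoc_castSucc]
      exact (measurable_pi_apply i).comp measurable_snd
  have hf : Measurable (fun Q : Factors (K + 1) N => ((Q (Fin.last K), fun k => Q k.castSucc) :
        (Fin (N (K + 1)) → Fin (N K) → ℂ) × Factors K N)) := by fun_prop
  -- It is easier to push forward along the inverse map, since the product measure is determined by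
  -- its values on boxes.
  have hmap : ((rayleighLaw (N (K + 1)) (N K)).prod (factorsLaw K N)).map g =
      factorsLaw (K + 1) N := by
    symm
    refine Measure.pi_eq fun s hs => ?_
    rw [Measure.map_apply hg (MeasurableSet.univ_pi hs)]
    have : g ⁻¹' (Set.univ.pi s) = s (Fin.last K) ×ˢ (Set.univ.pi fun k : Fin K => s k.castSucc) := by
      ext p
      simp only [Set.mem_preimage, Set.mem_pi, Set.mem_univ, true_implies, Set.mem_prod, g]
      rw [Fin.forall_fin_succ']
      simp only [Fin.snoc_last, Fin.snoc_castSucc]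
      tauto
    rw [this, Measure.prod_prod, factorsLaw, Measure.pi_pi, Fin.prod_univ_castSucc, mul_comm]
    rfl
  refine ⟨hf, ?_⟩
  rw [← hmap, Measure.map_map hf hg]
  convert Measure.map_id
  ext p : 1
  simp [g]

lemma continuous_of_mul_channel (K : ℕ) (N : ℕ → ℕ) :
    Continuous fun p : (Fin (N (K + 1)) → Fin (N K) → ℂ) × Factors K N =>
      Matrix.of p.1 * channel K N p.2 :=
  Continuous.matrix_mul (A := fun p : (Fin (N (K + 1)) → Fin (N K) → ℂ) × Factors K N =>
    Matrix.of p.1) continuous_fst ((continuous_channel K N).comp continuous_snd)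

variable {K : ℕ} {N : ℕ → ℕ}

lemma ae_gramDet_channel_ne_zero (hN : ∀ k ∈ Finset.Icc 1 K, N 0 ≤ N k) :
    ∀ᵐ Q ∂(factorsLaw K N), gramDet (channel K N Q) ≠ 0 := by
  induction K with
  | zero =>
    refine ae_of_all _ fun Q => ?_
    simp [channel, gramDet]
  | succ K ih =>
    have ih := ih fun k hk => hN k (by simp at hk ⊢; omega)
    have hK := hN (K + 1) (by simp)
    refine (measurePreserving_split_last K N).quasiMeasurePreserving.ae
      (p := fun p => gramDet (Matrix.of p.1 * channel K N p.2) ≠ 0) ?_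
    have hm : MeasurableSet {p : (Fin (N (K + 1)) → Fin (N K) → ℂ) × Factors K N |
        gramDet (Matrix.of p.1 * channel K N p.2) ≠ 0} :=
      (continuous_gramDet (continuous_of_mul_channel K N)).measurable
        (measurableSet_singleton 0).compl
    -- The order is swapped so that the inner product is fixed first and the last factor varies.
    rw [Measure.ae_prod_iff_ae_ae hm, Measure.ae_ae_comm hm]
    filter_upwards [ih] with Q hQ
    exact ae_gramDet_mul_ne_zero hK hQ

/-- Write `G = (G - g) + g`: the increment has law `ρ` whatever the second coordinate is, so
integrability and means add. -/
lemma integral_prod_of_map_sub_eq {α β : Type*} [MeasurableSpace α] [MeasurableSpace β]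
    {μ : Measure α} {ν : Measure β} [IsProbabilityMeasure μ] [IsProbabilityMeasure ν]
    {ρ : Measure ℝ} {G : α × β → ℝ} {g : β → ℝ} (hG : Measurable G) (hg : Measurable g)
    (hgI : Integrable g ν) (hρ : Integrable id ρ)
    (h : ∀ᵐ b ∂ν, μ.map (fun a => G (a, b) - g b) = ρ) :
    Integrable G (μ.prod ν) ∧ ∫ p, G p ∂(μ.prod ν) = ∫ b, g b ∂ν + ∫ x, x ∂ρ := by
  have hF : Measurable fun p : α × β => G p - g p.2 := hG.sub (hg.comp measurable_snd)
  have hmap := map_prod_eq_of_ae_map_eq hF h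
  have hFI : Integrable (fun p : α × β => G p - g p.2) (μ.prod ν) := by
    rw [← hmap] at hρ
    exact (integrable_map_measure aestronglyMeasurable_id hF.aemeasurable).mp hρ
  have hgI' : Integrable (fun p : α × β => g p.2) (μ.prod ν) := hgI.comp_snd μ
  have hsum : (fun p : α × β => (G p - g p.2) + g p.2) = G := by
    ext p
    ring
  constructor
  · rw [← hsum]
    exact hFI.add hgI'
  · have hE := integral_add hFI hgI'
    simp only [sub_add_cancel] at hE
    rw [hE, add_comm (∫ b, g b ∂ν), ← hmap, integral_map hF.aemeasurable (f := fun x : ℝ => x) aestronglyMeasurable_id,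
      integral_fun_snd]
    simp

/-- The mean of `log det (Hᴴ H)` for the product channel. -/
lemma log_gramDet_channel (hN : ∀ k ∈ Finset.Icc 1 K, N 0 ≤ N k) :
    Integrable (fun Q => Real.log (gramDet (channel K N Q))) (factorsLaw K N) ∧
      ∫ Q, Real.log (gramDet (channel K N Q)) ∂(factorsLaw K N) =
        ∑ k ∈ Finset.Icc 1 K, ∑ i ∈ Finset.range (N 0), digamma (N k - i : ℕ) := by
  induction K with
  | zero => simp [channel, gramDet]
  | succ K ih =>
    have hN' : ∀ k ∈ Finset.Icc 1 K, N 0 ≤ N k := fun k hk => hN k (by simp at hk ⊢; omega)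
    obtain ⟨ih1, ih2⟩ := ih hN'
    have hK := hN (K + 1) (by simp)
    have hmp := measurePreserving_split_last K N
    have hlm : Measurable fun Q : Fin (N (K + 1)) → Fin (N 0) → ℂ =>
        Real.log (gramDet (Matrix.of Q)) :=
      (continuous_gramDet (by fun_prop)).measurable.log
    have hlog : Integrable id ((rayleighLaw (N (K + 1)) (N 0)).map
        fun Q => Real.log (gramDet (Matrix.of Q))) :=
      (integrable_map_measure aestronglyMeasurable_id hlm.aemeasurable).mpr
        (integrable_log_gramDet hK)
    have hmap : ∀ᵐ Q' ∂(factorsLaw K N), (rayleighLaw (N (K + 1)) (N K)).map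
        (fun Q => Real.log (gramDet (Matrix.of Q * channel K N Q')) -
          Real.log (gramDet (channel K N Q'))) =
        (rayleighLaw (N (K + 1)) (N 0)).map (fun Q => Real.log (gramDet (Matrix.of Q))) := by
      filter_upwards [ae_gramDet_channel_ne_zero hN'] with Q' hQ'
      exact map_log_gramDet_mul_sub hK hQ'
    obtain ⟨hI, hE⟩ := integral_prod_of_map_sub_eq (μ := rayleighLaw (N (K + 1)) (N K))
      (G := fun p => Real.log (gramDet (Matrix.of p.1 * channel K N p.2)))
      (continuous_gramDet (continuous_of_mul_channel K N)).measurable.log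
      (continuous_gramDet (continuous_channel K N)).measurable.log ih1 hlog
      hmap
    refine ⟨hmp.integrable_comp_of_integrable hI, ?_⟩
    rw [ih2, integral_map hlm.aemeasurable (f := fun x : ℝ => x) aestronglyMeasurable_id,
      integral_log_gramDet hK] at hE
    rw [Finset.sum_Icc_succ_top (by omega), ← hE, ← hmp.map_eq]
    refine Eq.symm (integral_map hmp.measurable.aemeasurable ?_)
    rw [hmp.map_eq]
    exact hI.aestronglyMeasurable

/-- The half-order inverse moment of the Gram matrix of the product channel. -/
lemma lintegral_sqrt_gramInvTrace_channel_le (h0 : 1 ≤ N 0)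
    (hN : ∀ k ∈ Finset.Icc 1 K, N 0 ≤ N k) :
    ∫⁻ Q, ENNReal.ofReal (Real.sqrt (gramInvTrace (channel K N Q))) ∂(factorsLaw K N) ≤
      ENNReal.ofReal (Real.sqrt (N 0) *
        ∏ k ∈ Finset.Icc 1 K, (2 * N 0 * Real.sqrt (N 0) / Real.sqrt (N k))) := by
  induction K with
  | zero => simp [channel, gramInvTrace]
  | succ K ih =>
    have hN' : ∀ k ∈ Finset.Icc 1 K, N 0 ≤ N k := fun k hk => hN k (by simp at hk ⊢; omega)
    have hK := hN (K + 1) (by simp)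
    have hmp := measurePreserving_split_last K N
    have hm : Measurable fun p : (Fin (N (K + 1)) → Fin (N K) → ℂ) × Factors K N =>
        ENNReal.ofReal (Real.sqrt (gramInvTrace (Matrix.of p.1 * channel K N p.2))) :=
      (measurable_gramInvTrace (continuous_of_mul_channel K N)).sqrt.ennreal_ofReal
    have hm2 : Measurable fun Q : Factors K N =>
        ENNReal.ofReal (Real.sqrt (gramInvTrace (channel K N Q))) :=
      (measurable_gramInvTrace (continuous_channel K N)).sqrt.ennreal_ofReal
    calc _ = ∫⁻ p, ENNReal.ofReal (Real.sqrt (gramInvTrace (Matrix.of p.1 * channel K N p.2)))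
          ∂((rayleighLaw (N (K + 1)) (N K)).prod (factorsLaw K N)) := by
          rw [← hmp.map_eq, lintegral_map hm hmp.measurable]
          rfl
      _ = ∫⁻ Q', ∫⁻ Q, ENNReal.ofReal (Real.sqrt (gramInvTrace (Matrix.of Q * channel K N Q')))
          ∂(rayleighLaw (N (K + 1)) (N K)) ∂(factorsLaw K N) :=
          lintegral_prod_symm _ hm.aemeasurable
      _ ≤ ∫⁻ Q', ENNReal.ofReal (2 * N 0 * Real.sqrt (N 0) / Real.sqrt (N (K + 1))) *
          ENNReal.ofReal (Real.sqrt (gramInvTrace (channel K N Q'))) ∂(factorsLaw K N) := by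
          refine lintegral_mono_ae ?_
          filter_upwards [ae_gramDet_channel_ne_zero hN'] with Q' hQ'
          exact lintegral_sqrt_gramInvTrace_mul_le h0 hK hQ'
      _ ≤ ENNReal.ofReal (2 * N 0 * Real.sqrt (N 0) / Real.sqrt (N (K + 1))) *
          ENNReal.ofReal (Real.sqrt (N 0) *
            ∏ k ∈ Finset.Icc 1 K, (2 * N 0 * Real.sqrt (N 0) / Real.sqrt (N k))) := by
          rw [lintegral_const_mul _ hm2]
          gcongr
          exact ih hN'
      _ = _ := by
          rw [← ENNReal.ofReal_mul (by positivity), Finset.prod_Icc_succ_top (by omega)]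
          congr 1
          ring

end Product

/-! ### Expansion of the ergodic capacity -/

section Capacity

variable {K : ℕ} {N : ℕ → ℕ}

lemma measurable_capacity (K : ℕ) (N : ℕ → ℕ) (q : ℝ) : Measurable (capacity K N q) := by
  have h : Continuous fun Q : Factors K N => ((channel K N Q)ᴴ * channel K N Q) :=
    (continuous_channel K N).matrix_conjTranspose.matrix_mul (continuous_channel K N)
  exact (Complex.continuous_re.comp
    (continuous_const.add (h.const_smul (q : ℂ))).matrix_det).measurable.log

/-- The high-power expansion of the ergodic capacity with an explicit remainder. -/
lemma capacity_expansion (h0 : 1 ≤ N 0) (hN : ∀ k ∈ Finset.Icc 1 K, N 0 ≤ N k) {q : ℝ}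
    (hq : 0 < q) :
    Integrable (capacity K N q) (factorsLaw K N) ∧
      |ergodicCapacity K N q - (N 0 * Real.log q +
        ∑ k ∈ Finset.Icc 1 K, ∑ i ∈ Finset.range (N 0), digamma (N k - i : ℕ))| ≤
      2 * N 0 * (Real.sqrt (N 0) * (2 * N 0 * Real.sqrt (N 0)) ^ K) / Real.sqrt (snr K N q) := by
  obtain ⟨hI, hE⟩ := log_gramDet_channel hN
  set B : ℝ := Real.sqrt (N 0) *
        ∏ k ∈ Finset.Icc 1 K, (2 * N 0 * Real.sqrt (N 0) / Real.sqrt (N k)) with hB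
  have hB0 : 0 ≤ B := by positivity
  have hT := lintegral_sqrt_gramInvTrace_channel_le h0 hN
  have hTm : Measurable fun Q : Factors K N => Real.sqrt (gramInvTrace (channel K N Q)) :=
    (measurable_gramInvTrace (continuous_channel K N)).sqrt
  have hTI : Integrable (fun Q => Real.sqrt (gramInvTrace (channel K N Q))) (factorsLaw K N) := by
    refine ⟨hTm.aestronglyMeasurable, ?_⟩
    rw [hasFiniteIntegral_iff_ofReal (ae_of_all _ fun _ => Real.sqrt_nonneg _)]
    exact hT.trans_lt ENNReal.ofReal_lt_top
  have hTE : ∫ Q, Real.sqrt (gramInvTrace (channel K N Q)) ∂(factorsLaw K N) ≤ B := by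
    rw [integral_eq_lintegral_of_nonneg_ae (ae_of_all _ fun _ => Real.sqrt_nonneg _)
      hTm.aestronglyMeasurable]
    exact ENNReal.toReal_le_of_le_ofReal hB0 hT
  let D : Factors K N → ℝ := fun Q => capacity K N q Q -
    (N 0 * Real.log q + Real.log (gramDet (channel K N Q)))
  have hD : ∀ᵐ Q ∂(factorsLaw K N), 0 ≤ D Q ∧
      D Q ≤ 2 * N 0 / Real.sqrt q * Real.sqrt (gramInvTrace (channel K N Q)) := by
    filter_upwards [ae_gramDet_channel_ne_zero hN] with Q hQ
    obtain ⟨h1, h2⟩ := log_det_one_add_smul_bounds (channel K N Q) hQ hq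
    refine ⟨h1, h2.trans (le_of_eq ?_)⟩
    rw [Real.sqrt_div (gramInvTrace_nonneg _)]
    ring
  have hmain : Integrable (fun Q => N 0 * Real.log q + Real.log (gramDet (channel K N Q)))
      (factorsLaw K N) := (integrable_const _).add hI
  have hDI : Integrable D (factorsLaw K N) := by
    refine (hTI.const_mul (2 * N 0 / Real.sqrt q)).mono'
      ((measurable_capacity K N q).aestronglyMeasurable.sub hmain.aestronglyMeasurable) ?_
    filter_upwards [hD] with Q hQ
    rw [Real.norm_eq_abs, abs_of_nonneg hQ.1]
    exact hQ.2
  have hcap : capacity K N q = fun Q => D Q +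
      (N 0 * Real.log q + Real.log (gramDet (channel K N Q))) := by
    ext Q
    simp [D]
  refine ⟨hcap ▸ hDI.add hmain, ?_⟩
  have hEC : ergodicCapacity K N q - (N 0 * Real.log q +
        ∑ k ∈ Finset.Icc 1 K, ∑ i ∈ Finset.range (N 0), digamma (N k - i : ℕ)) =
      ∫ Q, D Q ∂(factorsLaw K N) := by
    unfold ergodicCapacity
    rw [hcap, integral_add hDI hmain, integral_add (integrable_const _) hI, hE]
    simp
  rw [hEC, abs_of_nonneg (integral_nonneg_of_ae (hD.mono fun _ h => h.1))]
  calc _ ≤ ∫ Q, 2 * N 0 / Real.sqrt q * Real.sqrt (gramInvTrace (channel K N Q))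
        ∂(factorsLaw K N) :=
        integral_mono_ae hDI (hTI.const_mul _) (hD.mono fun _ h => h.2)
    _ ≤ 2 * N 0 / Real.sqrt q * B := by
        rw [integral_const_mul]
        gcongr
    _ = _ := by
        -- The factors `√q` and `√(N k)` combine to `√SNR`; what is left depends only on `K` and `N
        -- 0`.
        rw [hB, snr, Real.sqrt_mul hq.le, Finset.prod_div_distrib, Finset.prod_const,
          Real.sqrt_prod _ (fun _ _ => Nat.cast_nonneg _)]
        simp only [Nat.card_Icc, Nat.add_sub_cancel]
        ring

end Capacity

/-! ### Digamma differences -/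

section Digamma

lemma digamma_add_one {x : ℝ} (hx : 0 < x) : digamma (x + 1) = digamma x + 1 / x := by
  have h := Complex.digamma_apply_add_one (x : ℂ) fun m hm => by
    have := congrArg Complex.re hm
    simp at this
    have hm : (0 : ℝ) ≤ m := m.cast_nonneg
    linarith
  unfold digamma
  push_cast
  rw [h, Complex.add_re, ← Complex.ofReal_inv, Complex.ofReal_re, one_div]

lemma digamma_sub_eq_sum {M N l : ℕ} (hMN : M ≤ N) (hl : l ≤ M) :
    digamma ((N : ℝ) - l + 1) - digamma ((M : ℝ) - l + 1) =
      ∑ s ∈ Finset.Ico M N, 1 / ((s : ℝ) - l + 1) := by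
  induction N, hMN using Nat.le_induction with
  | base => simp
  | succ N hN ih =>
    rw [Finset.sum_Ico_succ_top hN, ← ih]
    have hlN : (l : ℝ) ≤ N := by exact_mod_cast hl.trans hN
    have := digamma_add_one (x := (N : ℝ) - l + 1) (by linarith)
    push_cast
    rw [show (N : ℝ) + 1 - l + 1 = (N : ℝ) - l + 1 + 1 by ring, this]
    ring

lemma sum_range_digamma {N n : ℕ} (h : n ≤ N) :
    ∑ i ∈ Finset.range n, digamma (N - i : ℕ) =
      ∑ l ∈ Finset.Icc 1 n, digamma ((N : ℝ) - l + 1) := by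
  -- The reindexing is `l = i + 1`; truncated subtraction is harmless because `i < n ≤ N`.
  rw [← Finset.Ico_add_one_right_eq_Icc, Finset.sum_Ico_eq_sum_range]
  refine Finset.sum_congr (by simp) fun i hi => ?_
  rw [Nat.cast_sub (by simp at hi; omega)]
  congr 1
  push_cast
  ring

end Digamma

/-- The ergodic capacity at high signal-to-noise ratio, uniformly in the sizes. -/
lemma ergodicCapacity_uniform (K N₀ : ℕ) (hN₀ : 1 ≤ N₀) {ε : ℝ} (hε : 0 < ε) :
    ∃ S : ℝ, 0 < S ∧ ∀ N : ℕ → ℕ, N 0 = N₀ → (∀ k ∈ Finset.Icc 1 K, N₀ ≤ N k) →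
      ∀ q : ℝ, 0 < q → S ≤ snr K N q →
        |ergodicCapacity K N q - (N₀ * Real.log q +
          ∑ k ∈ Finset.Icc 1 K, ∑ l ∈ Finset.Icc 1 N₀, digamma ((N k : ℝ) - l + 1))| < ε := by
  set C : ℝ := 2 * N₀ * (Real.sqrt N₀ * (2 * N₀ * Real.sqrt N₀) ^ K) with hC
  have hn : (0 : ℝ) < N₀ := by exact_mod_cast hN₀
  have hC0 : 0 < C := by positivity
  -- This threshold makes the error `C / √SNR` at most `ε / 2`, hence strictly below `ε`.
  refine ⟨(2 * C / ε) ^ 2, by positivity, fun N h0 hN q hq hS => ?_⟩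
  subst h0
  have h := (capacity_expansion hN₀ hN hq).2
  rw [Finset.sum_congr rfl fun k hk => sum_range_digamma (hN k hk)] at h
  refine h.trans_lt ?_
  have h1 : 2 * C / ε ≤ Real.sqrt (snr K N q) := Real.le_sqrt_of_sq_le hS
  have h2 : 0 < 2 * C / ε := by positivity
  rw [div_lt_iff₀ (h2.trans_le h1)]
  calc C < 2 * C := by linarith
    _ = ε * (2 * C / ε) := by field_simp
    _ ≤ _ := by gcongr

end RayleighProduct

end

theorem mainTheorem6 (K N₀ : ℕ) (hK : 1 ≤ K) (hN₀ : 1 ≤ N₀) :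
    -- the ergodic capacities are expectations of integrable random variables
    (∀ N : ℕ → ℕ, N 0 = N₀ → (∀ k ∈ Finset.Icc 1 K, N₀ ≤ N k) → ∀ q : ℝ, 0 < q →
      Integrable (RayleighProduct.capacity K N q) (RayleighProduct.factorsLaw K N)) ∧
    -- the increment over the all-square setting, when both settings are at high SNR
    (∀ ε : ℝ, 0 < ε → ∃ S : ℝ, 0 < S ∧
      ∀ N : ℕ → ℕ, N 0 = N₀ → (∀ k ∈ Finset.Icc 1 K, N₀ ≤ N k) → ∀ q : ℝ, 0 < q →
        S ≤ RayleighProduct.snr K N q → S ≤ RayleighProduct.snr K (fun _ => N₀) q →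
        |(RayleighProduct.ergodicCapacity K N q -
            RayleighProduct.ergodicCapacity K (fun _ => N₀) q) -
          ∑ k ∈ Finset.Icc 1 K, ∑ l ∈ Finset.Icc 1 N₀,
            (RayleighProduct.digamma ((N k : ℝ) - l + 1) -
              RayleighProduct.digamma ((N₀ : ℝ) - l + 1))| < ε) ∧
    -- the closed form of that increment
    (∀ N : ℕ → ℕ, N 0 = N₀ → (∀ k ∈ Finset.Icc 1 K, N₀ ≤ N k) →
      ∑ k ∈ Finset.Icc 1 K, ∑ l ∈ Finset.Icc 1 N₀,
          (RayleighProduct.digamma ((N k : ℝ) - l + 1) -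
            RayleighProduct.digamma ((N₀ : ℝ) - l + 1)) =
        ∑ k ∈ Finset.Icc 1 K, ∑ l ∈ Finset.Icc 1 N₀, ∑ s ∈ Finset.Ico N₀ (N k),
          1 / ((s : ℝ) - l + 1)) ∧
    -- the increment from one more antenna at tier `k`, at high SNR
    (∀ ε : ℝ, 0 < ε → ∃ S : ℝ, 0 < S ∧
      ∀ N : ℕ → ℕ, N 0 = N₀ → (∀ k ∈ Finset.Icc 1 K, N₀ ≤ N k) →
        ∀ k ∈ Finset.Icc 1 K, ∀ q : ℝ, 0 < q → S ≤ RayleighProduct.snr K N q →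
        |(RayleighProduct.ergodicCapacity K (Function.update N k (N k + 1)) q -
            RayleighProduct.ergodicCapacity K N q) -
          ∑ l ∈ Finset.Icc 1 N₀, 1 / ((N k : ℝ) - l + 1)| < ε) := by
  refine ⟨fun N h0 hN q hq => ?_, fun ε hε => ?_, fun N h0 hN => ?_, fun ε hε => ?_⟩
  · subst h0
    exact (RayleighProduct.capacity_expansion hN₀ hN hq).1
  -- Each of the two settings is allotted an error `ε / 2`, and their common term `N₀ log q`
  -- cancels.
  · obtain ⟨S, hS, h⟩ := RayleighProduct.ergodicCapacity_uniform K N₀ hN₀ (half_pos hε)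
    refine ⟨S, hS, fun N h0 hN q hq h1 h2 => ?_⟩
    have e1 := abs_lt.mp (h N h0 hN q hq h1)
    have e2 := abs_lt.mp (h (fun _ => N₀) rfl (fun _ _ => le_rfl) q hq h2)
    simp only [Finset.sum_sub_distrib]
    rw [abs_lt]
    constructor <;> linarith [e1.1, e1.2, e2.1, e2.2]
  · refine Finset.sum_congr rfl fun k hk => Finset.sum_congr rfl fun l hl => ?_
    exact RayleighProduct.digamma_sub_eq_sum (hN k hk) (Finset.mem_Icc.mp hl).2
  · obtain ⟨S, hS, h⟩ := RayleighProduct.ergodicCapacity_uniform K N₀ hN₀ (half_pos hε)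
    refine ⟨S, hS, fun N h0 hN k hk q hq h1 => ?_⟩
    set N' := Function.update N k (N k + 1) with hN'
    have hle : ∀ j, N j ≤ N' j := by
      intro j
      rcases eq_or_ne j k with rfl | hj
      · simp [hN']
      · simp [hN', hj]
    have hk0 : k ≠ 0 := by
      have := (Finset.mem_Icc.mp hk).1
      omega
    have h0' : N' 0 = N₀ := by simp [hN', hk0.symm, h0]
    -- An extra antenna only raises the SNR, so the threshold for `N` also covers `N'`.
    have hsnr : RayleighProduct.snr K N q ≤ RayleighProduct.snr K N' q := by
      unfold RayleighProduct.snr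
      gcongr with j hj
      exact hle j
    have e1 := abs_lt.mp (h N h0 hN q hq h1)
    have e2 := abs_lt.mp (h N' h0' (fun j hj => (hN j hj).trans (hle j)) q hq (h1.trans hsnr))
    have hdiff : (∑ j ∈ Finset.Icc 1 K, ∑ l ∈ Finset.Icc 1 N₀,
          RayleighProduct.digamma ((N' j : ℝ) - l + 1)) -
        ∑ j ∈ Finset.Icc 1 K, ∑ l ∈ Finset.Icc 1 N₀,
          RayleighProduct.digamma ((N j : ℝ) - l + 1) =
        ∑ l ∈ Finset.Icc 1 N₀, 1 / ((N k : ℝ) - l + 1) := by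
      -- Only tier `k` changes, and there one step of the digamma recurrence gives the reciprocal.
      rw [← Finset.sum_sub_distrib, Finset.sum_eq_single_of_mem k hk]
      · rw [← Finset.sum_sub_distrib]
        refine Finset.sum_congr rfl fun l hl => ?_
        have := RayleighProduct.digamma_sub_eq_sum (Nat.le_succ (N k))
          ((Finset.mem_Icc.mp hl).2.trans (hN k hk))
        rw [Nat.succ_eq_add_one, Nat.Ico_succ_singleton, Finset.sum_singleton] at this
        simpa [hN'] using this
      · intro j _ hj
        simp [hN', hj]
    rw [abs_lt]
    constructor <;> linarith [e1.1, e1.2, e2.1, e2.2]
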